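/- Let $V_l,V_m,V_r:\mathbb{R}\to\mathbb{R}$ be $C^3$ functions. For $L>0$ put $V(u,x)=V_l(u)$ for $x<-L$, $V(u,x)=V_m(u)$ for $|x|<L$ and $V(u,x)=V_r(u)$ for $x>L$. A stationary front of $u_{tt}=u_{xx}+\frac{\partial}{\partial u}V(u,x)-\alpha u_t$ (with $\alpha\ge0$) with middle interval $(-L,L)$ is a $C^1$ function $u$ on $\mathbb{R}$ that satisfies $0=u_{xx}+\frac{\partial}{\partial u}V(u,x)$ on each of $(-\infty,-L)$, $(-L,L)$, $(L,\infty)$ and for which $u_x(x)\to0$ exponentially fast as $x\to\pm\infty$. Let $G\subset\mathbb{R}$ be open, let $L:G\to(0,\infty)$ be $C^1$, and for each $g\in G$ let $u_{\rm f}(\cdot;g)$ be a stationary front with middle interval $(-L(g),L(g))$, such that $\frac12(u_{\rm f})_x^2+V_m(u_{\rm f})=g$ on this interval, the limits of $u_{\rm f}(x;g)$ as $x\to\pm\infty$ do not depend on $g$, and $u_l(g)=u_{\rm f}(-L(g);g)$, $p_l(g)=(u_{\rm f})_x(-L(g);g)$, $u_r(g)=u_{\rm f}(L(g);g)$, $p_r(g)=(u_{\rm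 f})_x(L(g);g)$ are continuous in $g$. (So $L$ is a smooth length curve of fronts, parametrised by the Hamiltonian $g$ of the middle interval.) Put \[ \mathscr{B}_l(g)=p_l(g)\,[V_m'(u_l(g))-V_l'(u_l(g))],\qquad \mathscr{B}_r(g)=p_r(g)\,[V_r'(u_r(g))-V_m'(u_r(g))], \] and let $\Pi(g)=1$ if $(u_{\rm f})_x(x;g)\,(u_{\rm f})_x(-x;g)>0$ for all large $x$, $\Pi(g)=-1$ if this product is negative for all large $x$, and $\Pi(g)=0$ otherwise. Let $g\in G$ be such that all zeroes of $(u_{\rm f})_x(\cdot;g)$ (away from $x=\pm L(g)$) are simple. If \[ \Pi(g)\,\mathscr{B}_l(g)\,\mathscr{B}_r(g)\,L'(g)>0, \] then the front $u_{\rm f}(\cdot;g)$ is linearly unstable, i.e. the linearisation operator $\mathcal{L}(g)=D_{xx}+\frac{\partial^2V}{\partial u^2}(u_{\rm f}(x;g),x)$ on $L^2(\mathbb{R})$ with domain $H^2(\mathbb{R})$ has an eigenvalue $\Lambda>0$. -/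

import Mathlib

open MeasureTheory Filter Topology Set
open scoped ContDiff

noncomputable section

/-- A potential consisting of three `C³` functions: `Vl` is used on the left interval `(-∞, -L)`,
`Vm` on the middle interval `(-L, L)` and `Vr` on the right interval `(L, ∞)`. -/
structure PiecewisePotential where
  Vl : ℝ → ℝ
  Vm : ℝ → ℝ
  Vr : ℝ → ℝ
  contDiff_l : ContDiff ℝ 3 Vl
  contDiff_m : ContDiff ℝ 3 Vm
  contDiff_r : ContDiff ℝ 3 Vr

namespace PiecewisePotential

/-- The inhomogeneous potential `V(u, x)` whose middle interval is `(-L, L)`. The values at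
`x = ± L` are immaterial: they are never used below. -/
def val (V : PiecewisePotential) (L : ℝ) (w x : ℝ) : ℝ :=
  if x < -L then V.Vl w else if x ≤ L then V.Vm w else V.Vr w

/-- `∂V/∂u (w, x)`. -/
def du (V : PiecewisePotential) (L : ℝ) (w x : ℝ) : ℝ :=
  deriv (fun v => V.val L v x) w

/-- `∂²V/∂u² (w, x)`. -/
def duu (V : PiecewisePotential) (L : ℝ) (w x : ℝ) : ℝ :=
  iteratedDeriv 2 (fun v => V.val L v x) w

end PiecewisePotential

/-- `u` is a stationary front (or solitary wave) of
`u_tt = u_xx + ∂V/∂u (u, x) - α u_t` with middle interval `(-L, L)`: a `C¹` function on `ℝ` that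
solves `0 = u_xx + ∂V/∂u (u, x)` on the three open intervals, whose derivative tends to `0`
exponentially fast at `± ∞`, and with limits `um` at `-∞` and `up` at `+∞`. -/
structure IsStationaryFront (V : PiecewisePotential) (L : ℝ) (um up : ℝ) (u : ℝ → ℝ) : Prop where
  contDiff : ContDiff ℝ 1 u
  ode : ∀ x, x ≠ -L → x ≠ L → HasDerivAt (deriv u) (-(V.du L (u x) x)) x
  decay : ∃ C κ : ℝ, 0 < κ ∧ ∀ x, |deriv u x| ≤ C * Real.exp (-κ * |x|)
  tendsto_atBot : Tendsto u atBot (𝓝 um)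
  tendsto_atTop : Tendsto u atTop (𝓝 up)

/-- `L : G → (0, ∞)` is a smooth length curve with fronts `uf g`, `g ∈ G`: for every `g` in the
open set `G`, the function `uf g` is a stationary front whose middle interval is `(-L g, L g)`
and on whose middle interval the Hamiltonian `p² / 2 + V_m(u)` (with `p = u_x`) equals `g`;
the steady states `um`, `up` do not depend on `g`; `L` is `C¹`; and the values of `u` and `p` at
both ends of the middle interval are continuous (so single-valued) functions of `g`. -/
structure IsLengthCurve (V : PiecewisePotential) (um up : ℝ) (G : Set ℝ) (L : ℝ → ℝ)
    (uf : ℝ → ℝ → ℝ) : Prop where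
  isOpen : IsOpen G
  contDiffOn : ContDiffOn ℝ 1 L G
  pos : ∀ g ∈ G, 0 < L g
  front : ∀ g ∈ G, IsStationaryFront V (L g) um up (uf g)
  hamiltonian : ∀ g ∈ G, ∀ x ∈ Ioo (-(L g)) (L g),
    (deriv (uf g) x) ^ 2 / 2 + V.Vm (uf g x) = g
  continuousOn_ul : ContinuousOn (fun g => uf g (-(L g))) G
  continuousOn_pl : ContinuousOn (fun g => deriv (uf g) (-(L g))) G
  continuousOn_ur : ContinuousOn (fun g => uf g (L g)) G
  continuousOn_pr : ContinuousOn (fun g => deriv (uf g) (L g)) G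

/-- All zeroes of `u_x` are simple (`u_xx` exists away from the two points `± L`). -/
def HasSimpleDerivZeros (L : ℝ) (u : ℝ → ℝ) : Prop :=
  ∀ x, x ≠ -L → x ≠ L → deriv u x = 0 → deriv (deriv u) x ≠ 0

/-- The left bifurcation function `p_l [V_m'(u_l) - V_l'(u_l)]`, where `u_l = u(-L)` and
`p_l = u_x(-L)`. -/
def bifLeft (V : PiecewisePotential) (L : ℝ) (u : ℝ → ℝ) : ℝ :=
  deriv u (-L) * (deriv V.Vm (u (-L)) - deriv V.Vl (u (-L)))

/-- The right bifurcation function `p_r [V_r'(u_r) - V_m'(u_r)]`, where `u_r = u(L)` and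
`p_r = u_x(L)`. -/
def bifRight (V : PiecewisePotential) (L : ℝ) (u : ℝ → ℝ) : ℝ :=
  deriv u L * (deriv V.Vr (u L) - deriv V.Vm (u L))

open Classical in
/-- The sign `Π`: it is `1` if `u_x` has the same (nonzero) sign near `+∞` and near `-∞`, it is
`-1` if the signs are opposite, and `0` if neither is the case. -/
def asymptoticSign (u : ℝ → ℝ) : ℝ :=
  if ∀ᶠ x in atTop, 0 < deriv u x * deriv u (-x) then 1
  else if ∀ᶠ x in atTop, deriv u x * deriv u (-x) < 0 then -1
  else 0

/-- `f'` is a weak derivative of `f` on the real line. -/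
def IsWeakDeriv (f f' : ℝ → ℝ) : Prop :=
  ∀ φ : ℝ → ℝ, ContDiff ℝ ∞ φ → HasCompactSupport φ →
    ∫ x, f x * deriv φ x = -∫ x, f' x * φ x

/-- `Λ` is an eigenvalue of the linearisation operator
`D_xx + ∂²V/∂u² (u(x), x)` with domain `H²(ℝ)`: some `Ψ ∈ H²(ℝ)` that is not (almost everywhere)
zero, with weak derivatives `Ψ₁` and `Ψ₂` of order one and two in `L²(ℝ)`, satisfies
`Ψ₂ + ∂²V/∂u² (u(x), x) Ψ = Λ Ψ`. -/
def IsLinearisationEigenvalue (V : PiecewisePotential) (L : ℝ) (u : ℝ → ℝ) (Λ : ℝ) : Prop :=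
  ∃ Ψ Ψ₁ Ψ₂ : ℝ → ℝ,
    MemLp Ψ 2 ∧ MemLp Ψ₁ 2 ∧ MemLp Ψ₂ 2 ∧
    IsWeakDeriv Ψ Ψ₁ ∧ IsWeakDeriv Ψ₁ Ψ₂ ∧
    ¬ (Ψ =ᵐ[volume] 0) ∧
    ∀ᵐ x, Ψ₂ x + V.duu L (u x) x * Ψ x = Λ * Ψ x

end

/-! Let q be the coefficient V_uu along the front. For l ≥ 0 the equation y'' = (l - q) y has a
solution decaying at +∞ and, by reflection, one decaying at -∞ (Jost functions, each positive near
its own infinity). Their Wronskian W(l) acts as an Evans function: at a zero of W the solution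
decays at both ends and is an eigenfunction. For l > sup |q| convexity forces W(l) < 0
(`pos_and_deriv_neg`), so W(0) > 0 yields a zero Λ > 0 by the intermediate value theorem
(`exists_eigenfunction`).

It remains to find the sign of W(0). On each outer interval u_x solves the equation with l = 0,
decays and is eventually of one sign. This forces the limit of q there to be negative
(`limit_neg_of_pos_decaying_solution`) and makes the Jost function a multiple of u_x
(`exists_pos_eq_mul`); the signs of the two multiples produce Π. Let ψ continue the left u_x through
the middle interval. The core identity `IsLengthCurve.wronskian_eq` says that the Wronskian of ψ
with the right u_x at L is 2 L' B_l B_r, so W(0) is a positive multiple of Π B_l B_r L'.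

The identity comes from varying g. The left endpoint of the middle orbit moves along a fixed energy
curve of V_l, hence tangentially to the Cauchy data of ψ; the right endpoint moves along a fixed
energy curve of V_r, while the travel time changes by 2 L'. The variation of the orbit solves the
linearised equation, so its Wronskian with ψ is the same at both ends, namely zero.
Differentiability of the fronts in g is not assumed: differences of two orbits replace the
variation, and their Wronskian with ψ is constant up to second order
(`exists_abs_wronskian_sub_le`). -/

noncomputable section

/-! ### Calculus off a countable exceptional set, and integrals over half-lines -/

theorem hasDerivAt_comp_neg_of_eq {F : ℝ → ℝ} {d e x : ℝ} (h : HasDerivAt F d (-x))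
    (he : e = -d) : HasDerivAt (fun y => F (-y)) e x :=
  (h.comp x (hasDerivAt_neg x)).congr_deriv (by rw [he]; ring)

/-- The fundamental theorem of calculus tolerates countably many exceptional points, so F is a
primitive of F', and continuity of F' does the rest. It removes the points ± L, where q jumps, from
first-order statements. -/
theorem hasDerivAt_of_hasDerivAt_off_countable {F F' : ℝ → ℝ} {S : Set ℝ} (hS : S.Countable)
    (hF : Continuous F) (hF' : Continuous F') (hd : ∀ x ∉ S, HasDerivAt F (F' x) x) (x : ℝ) :
    HasDerivAt F (F' x) x := by
  have h1 : F = fun y => F x + ∫ t in x..y, F' t := by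
    ext y
    rw [integral_eq_of_hasDerivAt_off_countable F F' hS hF.continuousOn (fun z hz => hd z hz.2)
      (hF'.intervalIntegrable _ _)]
    ring
  rw [h1]
  exact (intervalIntegral.integral_hasDerivAt_right (hF'.intervalIntegrable _ _)
    (hF'.stronglyMeasurableAtFilter _ _) hF'.continuousAt).const_add (F x)

theorem monotone_of_hasDerivAt_off_countable {F F' : ℝ → ℝ} {S : Set ℝ} (hS : S.Countable)
    (hF : Continuous F) (hd : ∀ x ∉ S, HasDerivAt F (F' x) x)
    (hi : ∀ a b, IntervalIntegrable F' volume a b) (hF' : ∀ x, 0 ≤ F' x) : Monotone F := by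
  intro a b hab
  have h1 := integral_eq_of_hasDerivAt_off_countable F F' hS (a := a) (b := b) hF.continuousOn
    (fun z hz => hd z hz.2) (hi a b)
  have h2 : 0 ≤ ∫ t in a..b, F' t := intervalIntegral.integral_nonneg hab fun x _ => hF' x
  linarith

theorem eq_of_hasDerivAt_zero_off_countable {F : ℝ → ℝ} {S : Set ℝ} (hS : S.Countable)
    (hF : Continuous F) (hd : ∀ x ∉ S, HasDerivAt F 0 x) (a b : ℝ) : F a = F b := by
  have h1 := integral_eq_of_hasDerivAt_off_countable F (fun _ => 0) hS (a := a) (b := b)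
    hF.continuousOn (fun z hz => hd z hz.2) (by simp)
  simp only [intervalIntegral.integral_zero] at h1
  linarith

theorem integral_Ioi_eq_sub_intervalIntegral {g : ℝ → ℝ} (hg : ∀ x, IntegrableOn g (Ioi x))
    (x : ℝ) : ∫ s in Ioi x, g s = (∫ s in Ioi 0, g s) - ∫ s in (0 : ℝ)..x, g s := by
  rcases le_total 0 x with hx | hx
  · rw [← intervalIntegral.integral_Ioi_sub_Ioi (hg 0) hx]; ring
  · rw [intervalIntegral.integral_symm, ← intervalIntegral.integral_Ioi_sub_Ioi (hg x) hx]; ring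

theorem intervalIntegrable_of_integrableOn_Ioi {g : ℝ → ℝ} (hg : ∀ x, IntegrableOn g (Ioi x))
    (a b : ℝ) : IntervalIntegrable g volume a b := by
  rw [intervalIntegrable_iff]
  exact (hg (min a b)).mono_set fun x hx => hx.1

theorem continuous_integral_Ioi {g : ℝ → ℝ} (hg : ∀ x, IntegrableOn g (Ioi x)) :
    Continuous fun x => ∫ s in Ioi x, g s := by
  rw [funext (integral_Ioi_eq_sub_intervalIntegral hg)]
  exact continuous_const.sub
    (intervalIntegral.continuous_primitive (intervalIntegrable_of_integrableOn_Ioi hg) 0)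

theorem hasDerivAt_integral_Ioi {g : ℝ → ℝ} (hm : Measurable g)
    (hg : ∀ x, IntegrableOn g (Ioi x)) {x : ℝ} (hx : ContinuousAt g x) :
    HasDerivAt (fun x => ∫ s in Ioi x, g s) (-g x) x := by
  rw [funext (integral_Ioi_eq_sub_intervalIntegral hg)]
  exact (intervalIntegral.integral_hasDerivAt_right (intervalIntegrable_of_integrableOn_Ioi hg 0 x)
    hm.stronglyMeasurable.stronglyMeasurableAtFilter hx).const_sub _

/-! ### Jost amplitudes as fixed points of a contraction -/

/-- The kernel `(1 - e^{-2 μ t}) / (2 μ)` for `t ≥ 0`, extended by `0` to negative `t`. -/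
def jostKernel (μ t : ℝ) : ℝ := (1 - Real.exp (-(2 * μ) * max t 0)) / (2 * μ)

theorem jostKernel_nonneg {μ : ℝ} (hμ : 0 < μ) (t : ℝ) : 0 ≤ jostKernel μ t := by
  unfold jostKernel
  have : Real.exp (-(2 * μ) * max t 0) ≤ 1 := by
    rw [Real.exp_le_one_iff]
    nlinarith [le_max_right t 0]
  apply div_nonneg <;> linarith

theorem jostKernel_le {μ₀ μ : ℝ} (hμ₀ : 0 < μ₀) (hμ : μ₀ ≤ μ) (t : ℝ) :
    jostKernel μ t ≤ 1 / (2 * μ₀) := by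
  unfold jostKernel
  apply div_le_div₀ zero_le_one _ (by linarith) (by linarith)
  linarith [Real.exp_pos (-(2 * μ) * max t 0)]

theorem jostKernel_of_nonpos {μ t : ℝ} (ht : t ≤ 0) : jostKernel μ t = 0 := by
  simp [jostKernel, max_eq_right ht]

theorem jostKernel_of_nonneg {μ t : ℝ} (ht : 0 ≤ t) :
    jostKernel μ t = (1 - Real.exp (-(2 * μ) * t)) / (2 * μ) := by
  simp [jostKernel, max_eq_left ht]

/-- The assumptions for the construction of Jost functions: an exponentially small perturbation
`r`, and a continuous family of exponents `μ`, bounded from below by `μ₀ > 0`. -/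
structure JostData (r μ : ℝ → ℝ) (C κ μ₀ : ℝ) : Prop where
  measurable : Measurable r
  bound : ∀ s, |r s| ≤ C * Real.exp (-κ * s)
  C_pos : 0 < C
  κ_pos : 0 < κ
  μ₀_pos : 0 < μ₀
  continuous_μ : Continuous μ
  le_μ : ∀ l, μ₀ ≤ μ l

/-- The weight that turns the Jost integral operator into a contraction. -/
def jostWeight (C κ μ₀ x : ℝ) : ℝ := Real.exp (C / (κ * μ₀) * Real.exp (-κ * x))

/-- The density whose integral over `(x, ∞)` is `μ₀ (w(x) - 1)`, with `w` the weight. -/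
def jostDensity (C κ μ₀ x : ℝ) : ℝ := C * Real.exp (-κ * x) * jostWeight C κ μ₀ x

theorem continuous_jostWeight (C κ μ₀ : ℝ) : Continuous (jostWeight C κ μ₀) := by
  unfold jostWeight; fun_prop

theorem jostWeight_pos (C κ μ₀ x : ℝ) : 0 < jostWeight C κ μ₀ x := Real.exp_pos _

namespace JostData

variable {r μ : ℝ → ℝ} {C κ μ₀ : ℝ}

theorem one_le_weight (h : JostData r μ C κ μ₀) (x : ℝ) : 1 ≤ jostWeight C κ μ₀ x := by
  unfold jostWeight
  have := h.C_pos; have := h.κ_pos; have := h.μ₀_pos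
  rw [Real.one_le_exp_iff]; positivity

theorem weight_antitone (h : JostData r μ C κ μ₀) : Antitone (jostWeight C κ μ₀) := by
  intro x y hxy
  have := h.C_pos; have := h.κ_pos; have := h.μ₀_pos
  unfold jostWeight
  have hexp : Real.exp (-κ * y) ≤ Real.exp (-κ * x) := Real.exp_le_exp.2 (by nlinarith)
  gcongr

theorem density_nonneg (h : JostData r μ C κ μ₀) (x : ℝ) : 0 ≤ jostDensity C κ μ₀ x := by
  have := h.C_pos
  unfold jostDensity
  have := jostWeight_pos C κ μ₀ x
  positivity

theorem hasDerivAt_weight (h : JostData r μ C κ μ₀) (x : ℝ) :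
    HasDerivAt (fun s => -μ₀ * jostWeight C κ μ₀ s) (jostDensity C κ μ₀ x) x := by
  have h1 : HasDerivAt (fun s : ℝ => -κ * s) (-κ) x := by
    simpa using (hasDerivAt_id x).const_mul (-κ)
  have h2 := ((h1.exp.const_mul (C / (κ * μ₀))).exp).const_mul (-μ₀)
  have := h.κ_pos.ne'; have := h.μ₀_pos.ne'
  refine h2.congr_deriv ?_
  unfold jostDensity jostWeight
  field_simp

theorem tendsto_weight (h : JostData r μ C κ μ₀) :
    Tendsto (jostWeight C κ μ₀) atTop (𝓝 1) := by
  have h1 : Tendsto (fun x : ℝ => Real.exp (-κ * x)) atTop (𝓝 0) :=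
    Real.tendsto_exp_atBot.comp (tendsto_id.const_mul_atTop_of_neg (neg_lt_zero.2 h.κ_pos))
  have h2 := (h1.const_mul (C / (κ * μ₀))).rexp
  rw [mul_zero, Real.exp_zero] at h2
  exact h2

theorem integrableOn_density (h : JostData r μ C κ μ₀) (x : ℝ) :
    IntegrableOn (jostDensity C κ μ₀) (Ioi x) :=
  integrableOn_Ioi_deriv_of_nonneg' (fun y _ => h.hasDerivAt_weight y)
    (fun y _ => h.density_nonneg y) (h.tendsto_weight.const_mul (-μ₀))

theorem integral_density (h : JostData r μ C κ μ₀) (x : ℝ) :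
    ∫ s in Ioi x, jostDensity C κ μ₀ s = μ₀ * (jostWeight C κ μ₀ x - 1) := by
  rw [integral_Ioi_of_hasDerivAt_of_nonneg' (fun y _ => h.hasDerivAt_weight y)
    (fun y _ => h.density_nonneg y) (h.tendsto_weight.const_mul (-μ₀))]
  ring

theorem abs_mul_le (h : JostData r μ C κ μ₀) {g M s : ℝ} (hg : |g| ≤ M * jostWeight C κ μ₀ s) :
    |r s * g| ≤ M * jostDensity C κ μ₀ s := by
  rw [abs_mul]
  calc |r s| * |g| ≤ (C * Real.exp (-κ * s)) * (M * jostWeight C κ μ₀ s) := by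
        gcongr
        · exact (abs_nonneg _).trans (h.bound s)
        · exact h.bound s
    _ = M * jostDensity C κ μ₀ s := by unfold jostDensity; ring

theorem abs_kernel_mul_le (h : JostData r μ C κ μ₀) {g M s : ℝ} (l x : ℝ)
    (hg : |g| ≤ M * jostWeight C κ μ₀ s) :
    |jostKernel (μ l) (s - x) * (r s * g)| ≤
      (Ioi x).indicator (fun s => M / (2 * μ₀) * jostDensity C κ μ₀ s) s := by
  by_cases hs : s ∈ Ioi x
  · rw [indicator_of_mem hs, abs_mul, abs_of_nonneg (jostKernel_nonneg
      (h.μ₀_pos.trans_le (h.le_μ l)) _)]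
    calc _ ≤ 1 / (2 * μ₀) * (M * jostDensity C κ μ₀ s) :=
          mul_le_mul (jostKernel_le h.μ₀_pos (h.le_μ l) _) (h.abs_mul_le hg) (abs_nonneg _)
            (by have := h.μ₀_pos; positivity)
      _ = _ := by ring
  · rw [indicator_of_notMem hs, jostKernel_of_nonpos (by simpa using hs)]
    simp

theorem integrable_bound (h : JostData r μ C κ μ₀) (M x : ℝ) :
    Integrable ((Ioi x).indicator (fun s => M / (2 * μ₀) * jostDensity C κ μ₀ s)) :=
  IntegrableOn.integrable_indicator ((h.integrableOn_density x).const_mul _) measurableSet_Ioi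

theorem integral_bound (h : JostData r μ C κ μ₀) (M x : ℝ) :
    ∫ s, (Ioi x).indicator (fun s => M / (2 * μ₀) * jostDensity C κ μ₀ s) s =
      M / 2 * (jostWeight C κ μ₀ x - 1) := by
  rw [integral_indicator measurableSet_Ioi, integral_const_mul, h.integral_density]
  have := h.μ₀_pos.ne'
  field_simp

theorem measurable_integrand (h : JostData r μ C κ μ₀) {g : ℝ → ℝ} (hg : Continuous g) (l x : ℝ) :
    Measurable fun s => jostKernel (μ l) (s - x) * (r s * g s) := by
  have : Continuous fun s => jostKernel (μ l) (s - x) := by unfold jostKernel; fun_prop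
  exact this.measurable.mul (h.measurable.mul hg.measurable)

theorem integrable_integrand (h : JostData r μ C κ μ₀) {g : ℝ → ℝ} (hg : Continuous g) {M : ℝ}
    (hM : ∀ s, |g s| ≤ M * jostWeight C κ μ₀ s) (l x : ℝ) :
    Integrable fun s => jostKernel (μ l) (s - x) * (r s * g s) :=
  (h.integrable_bound M x).mono' (h.measurable_integrand hg l x).aestronglyMeasurable
    (Eventually.of_forall fun s => h.abs_kernel_mul_le l x (hM s))

/-- The kernel is at most 1 / (2 μ₀) and the density integrates to μ₀ (w - 1), so a function bounded
by M w is sent below (M / 2) (w - 1). This yields the contraction factor 1 / 2 for any C, and the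
limit 1 of the amplitude at +∞. -/
theorem abs_integral_le (h : JostData r μ C κ μ₀) {g : ℝ → ℝ} {M : ℝ}
    (hM : ∀ s, |g s| ≤ M * jostWeight C κ μ₀ s) (l x : ℝ) :
    |∫ s, jostKernel (μ l) (s - x) * (r s * g s)| ≤ M / 2 * (jostWeight C κ μ₀ x - 1) := by
  rw [← h.integral_bound, ← Real.norm_eq_abs]
  exact norm_integral_le_of_norm_le (h.integrable_bound M x)
    (Eventually.of_forall fun s => h.abs_kernel_mul_le l x (hM s))

theorem continuous_integral (h : JostData r μ C κ μ₀) {g : ℝ × ℝ → ℝ} (hg : Continuous g) {M : ℝ}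
    (hM : ∀ p, |g p| ≤ M * jostWeight C κ μ₀ p.2) :
    Continuous fun p : ℝ × ℝ => ∫ s, jostKernel (μ p.1) (s - p.2) * (r s * g (p.1, s)) := by
  have hM0 : 0 ≤ M := by
    have := (abs_nonneg _).trans (hM (0, 0))
    have hw := jostWeight_pos C κ μ₀ 0
    by_contra! hneg
    have := mul_neg_of_neg_of_pos hneg hw
    linarith
  rw [continuous_iff_continuousAt]
  rintro ⟨l₀, x₀⟩
  -- Enlarging the half-line to start at x₀ - 1 gives one dominating function for all base points
  -- near x₀.
  refine continuousAt_of_dominated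
    (bound := (Ioi (x₀ - 1)).indicator (fun s => M / (2 * μ₀) * jostDensity C κ μ₀ s)) ?_ ?_
    (h.integrable_bound M _) ?_
  · exact Eventually.of_forall fun p =>
      (h.measurable_integrand (g := fun s => g (p.1, s)) (by fun_prop) p.1 p.2).aestronglyMeasurable
  · have : ∀ᶠ p : ℝ × ℝ in 𝓝 (l₀, x₀), x₀ - 1 < p.2 :=
      continuous_snd.continuousAt.eventually (lt_mem_nhds (by simp))
    filter_upwards [this] with p hp
    refine Eventually.of_forall fun s => (h.abs_kernel_mul_le p.1 p.2 (hM (p.1, s))).trans ?_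
    refine indicator_le_indicator_of_subset (Ioi_subset_Ioi hp.le) (fun s => ?_) s
    have := h.density_nonneg s; have := h.μ₀_pos
    positivity
  · refine Eventually.of_forall fun s => Continuous.continuousAt ?_
    have hk : Continuous fun p : ℝ × ℝ => jostKernel (μ p.1) (s - p.2) := by
      unfold jostKernel
      have := h.continuous_μ
      refine Continuous.div (by fun_prop) (by fun_prop) fun p => ?_
      have := h.μ₀_pos.trans_le (h.le_μ p.1)
      positivity
    exact hk.mul (continuous_const.mul (by fun_prop))

/-- The Jost integral operator, conjugated with the weight. -/
def operator (h : JostData r μ C κ μ₀) (b : BoundedContinuousFunction (ℝ × ℝ) ℝ) :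
    BoundedContinuousFunction (ℝ × ℝ) ℝ :=
  have hM : ∀ p : ℝ × ℝ, |jostWeight C κ μ₀ p.2 * b p| ≤ ‖b‖ * jostWeight C κ μ₀ p.2 := fun p => by
    rw [abs_mul, abs_of_pos (jostWeight_pos C κ μ₀ p.2), mul_comm]
    exact mul_le_mul_of_nonneg_right (b.norm_coe_le_norm p) (jostWeight_pos C κ μ₀ p.2).le
  BoundedContinuousFunction.ofNormedAddCommGroup
    (fun p => (jostWeight C κ μ₀ p.2)⁻¹ *
      (1 + ∫ s, jostKernel (μ p.1) (s - p.2) * (r s * (jostWeight C κ μ₀ s * b (p.1, s)))))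
    (((continuous_jostWeight C κ μ₀).comp continuous_snd).inv₀
      (fun p => (jostWeight_pos C κ μ₀ p.2).ne') |>.mul (continuous_const.add
        (h.continuous_integral (g := fun p => jostWeight C κ μ₀ p.2 * b p)
        (((continuous_jostWeight C κ μ₀).comp continuous_snd).mul b.continuous) hM)))
    (1 + ‖b‖ / 2)
    (fun p => by
      have hw := jostWeight_pos C κ μ₀ p.2
      have h1 := h.abs_integral_le (fun s => hM (p.1, s)) p.1 p.2
      rw [norm_mul, norm_inv, Real.norm_eq_abs, Real.norm_eq_abs, abs_of_pos hw,
        inv_mul_le_iff₀ hw]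
      refine (abs_add_le _ _).trans ?_
      rw [abs_one]
      have := h.one_le_weight p.2
      have := norm_nonneg b
      refine (add_le_add_right h1 1).trans ?_
      nlinarith)

theorem operator_apply (h : JostData r μ C κ μ₀) (b : BoundedContinuousFunction (ℝ × ℝ) ℝ)
    (l x : ℝ) : h.operator b (l, x) = (jostWeight C κ μ₀ x)⁻¹ *
      (1 + ∫ s, jostKernel (μ l) (s - x) * (r s * (jostWeight C κ μ₀ s * b (l, s)))) := rfl

theorem contractingWith_operator (h : JostData r μ C κ μ₀) :
    ContractingWith (1 / 2) h.operator := by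
  refine ⟨by norm_num, LipschitzWith.of_dist_le_mul fun a b => ?_⟩
  rw [BoundedContinuousFunction.dist_le (by positivity)]
  rintro ⟨l, x⟩
  have hw := jostWeight_pos C κ μ₀ x
  have hM : ∀ (b : BoundedContinuousFunction (ℝ × ℝ) ℝ) (s : ℝ),
      |jostWeight C κ μ₀ s * b (l, s)| ≤ ‖b‖ * jostWeight C κ μ₀ s := fun b s => by
    rw [abs_mul, abs_of_pos (jostWeight_pos C κ μ₀ s), mul_comm]
    exact mul_le_mul_of_nonneg_right (b.norm_coe_le_norm _) (jostWeight_pos C κ μ₀ s).le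
  have hi : ∀ b : BoundedContinuousFunction (ℝ × ℝ) ℝ, Integrable fun s =>
      jostKernel (μ l) (s - x) * (r s * (jostWeight C κ μ₀ s * b (l, s))) := fun b =>
    h.integrable_integrand (g := fun s => jostWeight C κ μ₀ s * b (l, s))
      ((continuous_jostWeight C κ μ₀).mul (b.continuous.comp (by fun_prop))) (hM b) l x
  have h1 := h.abs_integral_le (hM (a - b)) l x
  have h2 : ∫ s, jostKernel (μ l) (s - x) * (r s * (jostWeight C κ μ₀ s * (a - b) (l, s))) =
      (∫ s, jostKernel (μ l) (s - x) * (r s * (jostWeight C κ μ₀ s * a (l, s)))) -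
      ∫ s, jostKernel (μ l) (s - x) * (r s * (jostWeight C κ μ₀ s * b (l, s))) := by
    rw [← integral_sub (hi a) (hi b)]
    congr 1; ext s
    simp only [BoundedContinuousFunction.coe_sub, Pi.sub_apply]
    ring
  rw [Real.dist_eq, operator_apply, operator_apply, ← mul_sub, add_sub_add_left_eq_sub, ← h2,
    abs_mul, abs_inv, abs_of_pos hw, inv_mul_le_iff₀ hw, dist_eq_norm]
  refine h1.trans ?_
  have := norm_nonneg (a - b)
  simp only [NNReal.coe_div, NNReal.coe_one, NNReal.coe_ofNat]
  nlinarith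

/-- The Jost function divided by its leading exponential `e^{-μ x}`. -/
theorem exists_amplitude (h : JostData r μ C κ μ₀) :
    ∃ (v : ℝ × ℝ → ℝ) (M : ℝ), Continuous v ∧ (∀ p, |v p| ≤ M * jostWeight C κ μ₀ p.2) ∧
      ∀ l x, v (l, x) = 1 + ∫ s, jostKernel (μ l) (s - x) * (r s * v (l, s)) := by
  have hc := h.contractingWith_operator
  set b := hc.fixedPoint
  have hb : h.operator b = b := hc.fixedPoint_isFixedPt
  refine ⟨fun p => jostWeight C κ μ₀ p.2 * b p, ‖b‖,
    ((continuous_jostWeight C κ μ₀).comp continuous_snd).mul b.continuous, fun p => ?_,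
    fun l x => ?_⟩
  · rw [abs_mul, abs_of_pos (jostWeight_pos C κ μ₀ p.2), mul_comm]
    exact mul_le_mul_of_nonneg_right (b.norm_coe_le_norm p) (jostWeight_pos C κ μ₀ p.2).le
  · have h1 : b (l, x) = h.operator b (l, x) := by rw [hb]
    simp only
    rw [h1, operator_apply, mul_inv_cancel_left₀ (jostWeight_pos C κ μ₀ x).ne']

end JostData

/-! ### From amplitudes to Jost functions -/

namespace JostData

variable {r μ : ℝ → ℝ} {C κ μ₀ : ℝ}

theorem integrableOn_mul (h : JostData r μ C κ μ₀) {v : ℝ → ℝ} (hv : Continuous v) {M : ℝ}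
    (hM : ∀ s, |v s| ≤ M * jostWeight C κ μ₀ s) (x : ℝ) :
    IntegrableOn (fun s => r s * v s) (Ioi x) :=
  ((h.integrableOn_density x).const_mul M).mono'
    (h.measurable.mul hv.measurable).aestronglyMeasurable
    (Eventually.of_forall fun s => h.abs_mul_le (hM s))

theorem integrableOn_exp_mul (h : JostData r μ C κ μ₀) {v : ℝ → ℝ} (hv : Continuous v) {M : ℝ}
    (hM : ∀ s, |v s| ≤ M * jostWeight C κ μ₀ s) {m : ℝ} (hm : 0 < m) (x : ℝ) :
    IntegrableOn (fun s => Real.exp (-(2 * m) * s) * (r s * v s)) (Ioi x) := by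
  refine ((h.integrableOn_mul hv hM x).norm.const_mul (Real.exp (-(2 * m) * x))).mono'
    (Measurable.aestronglyMeasurable ?_) ?_
  · exact (Continuous.measurable (by fun_prop)).mul (h.measurable.mul hv.measurable)
  · refine (ae_restrict_iff' measurableSet_Ioi).2 (Eventually.of_forall fun s hs => ?_)
    rw [norm_mul, Real.norm_eq_abs, Real.abs_exp]
    refine mul_le_mul_of_nonneg_right (Real.exp_le_exp.2 ?_) (norm_nonneg _)
    have : x < s := hs
    nlinarith

/-- Splitting the kernel leaves x only in the endpoint and in an exponential prefactor, so the
x-derivative can be taken by the fundamental theorem of calculus. -/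
theorem integral_kernel_eq (h : JostData r μ C κ μ₀) {v : ℝ → ℝ} (hv : Continuous v) {M : ℝ}
    (hM : ∀ s, |v s| ≤ M * jostWeight C κ μ₀ s) (l x : ℝ) :
    ∫ s, jostKernel (μ l) (s - x) * (r s * v s) =
      ((∫ s in Ioi x, r s * v s) - Real.exp (2 * μ l * x) *
        ∫ s in Ioi x, Real.exp (-(2 * μ l) * s) * (r s * v s)) / (2 * μ l) := by
  have hm : 0 < μ l := h.μ₀_pos.trans_le (h.le_μ l)
  rw [← integral_const_mul, ← integral_sub (h.integrableOn_mul hv hM x)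
    ((h.integrableOn_exp_mul hv hM hm x).const_mul _), ← integral_div,
    ← integral_indicator measurableSet_Ioi]
  congr 1
  ext s
  by_cases hs : s ∈ Ioi x
  · have hs' : 0 ≤ s - x := by have : x < s := hs; linarith
    rw [indicator_of_mem hs, jostKernel_of_nonneg hs', ← mul_assoc (Real.exp _), ← Real.exp_add]
    have : -(2 * μ l) * (s - x) = 2 * μ l * x + -(2 * μ l) * s := by ring
    rw [this]
    ring
  · rw [indicator_of_notMem hs, jostKernel_of_nonpos (by simpa using hs), zero_mul]

end JostData

/-- A family `f l`, `l ≥ 0`, of solutions of `y'' = (l - q) y` (with the equation holding off the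
exceptional set `S`) that decay exponentially at `+∞`, are positive near `+∞`, and whose Cauchy
data at `0` depend continuously on `l`; `f' l` is the derivative of `f l`. -/
structure IsJostFamily (q : ℝ → ℝ) (S : Set ℝ) (f f' : ℝ → ℝ → ℝ) : Prop where
  hasDerivAt : ∀ l, 0 ≤ l → ∀ x, HasDerivAt (f l) (f' l x) x
  continuous_deriv : ∀ l, 0 ≤ l → Continuous (f' l)
  ode : ∀ l, 0 ≤ l → ∀ x ∉ S, HasDerivAt (f' l) ((l - q x) * f l x) x
  continuousOn_zero : ContinuousOn (fun l => f l 0) (Ici 0)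
  continuousOn_deriv_zero : ContinuousOn (fun l => f' l 0) (Ici 0)
  decay : ∀ l, 0 ≤ l → ∃ C ν : ℝ, 0 < ν ∧
    ∀ x, 0 ≤ x → |f l x| ≤ C * Real.exp (-ν * x) ∧ |f' l x| ≤ C * Real.exp (-ν * x)
  eventually_pos : ∀ l, 0 ≤ l → ∀ᶠ x in atTop, 0 < f l x

/-- With y = e^{-μ x} v and μ² = l - qe the equation becomes v'' = 2 μ v' + r v, where r = qe - q.
Its solution with v → 1 is the fixed point of the Jost integral equation. -/
theorem exists_isJostFamily {q : ℝ → ℝ} {S : Set ℝ} (hS : S.Countable) (hq : Measurable q)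
    (hqc : ∀ x ∉ S, ContinuousAt q x) {qe C κ : ℝ} (hqe : qe < 0) (hκ : 0 < κ)
    (hb : ∀ x, |q x - qe| ≤ C * Real.exp (-κ * x)) :
    ∃ f f' : ℝ → ℝ → ℝ, IsJostFamily q S f f' := by
  set r : ℝ → ℝ := fun s => qe - q s with hr
  -- Truncating l at 0 keeps μ continuous and bounded below on the whole line; only l ≥ 0 matters
  -- later.
  set μ : ℝ → ℝ := fun l => √(max l 0 - qe) with hμ
  have h : JostData r μ (|C| + 1) κ (√(-qe)) :=
    { measurable := by fun_prop
      bound := fun s => by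
        rw [hr, abs_sub_comm]
        refine (hb s).trans (mul_le_mul_of_nonneg_right ?_ (Real.exp_pos _).le)
        linarith [le_abs_self C]
      C_pos := by positivity
      κ_pos := hκ
      μ₀_pos := Real.sqrt_pos.2 (by linarith)
      continuous_μ := by fun_prop
      le_μ := fun l => Real.sqrt_le_sqrt (by linarith [le_max_right l 0]) }
  obtain ⟨v, M, hv, hM, hfix⟩ := h.exists_amplitude
  set K := |C| + 1
  set μ₀ := √(-qe)
  have hμpos : ∀ l, 0 < μ l := fun l => h.μ₀_pos.trans_le (h.le_μ l)
  have hμsq : ∀ l, 0 ≤ l → μ l * μ l = l - qe := fun l hl => by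
    rw [hμ]; simp only; rw [Real.mul_self_sqrt (by linarith [le_max_right l 0]), max_eq_left hl]
  have hM0 : 0 ≤ M := by
    by_contra! hneg
    have := mul_neg_of_neg_of_pos hneg (jostWeight_pos K κ μ₀ 0)
    linarith [(abs_nonneg _).trans (hM (0, 0))]
  have hvl : ∀ l, Continuous fun s => v (l, s) := fun l => hv.comp (by fun_prop)
  have hMl : ∀ l s, |v (l, s)| ≤ M * jostWeight K κ μ₀ s := fun l s => hM (l, s)
  set B : ℝ → ℝ → ℝ := fun l x => ∫ s in Ioi x, Real.exp (-(2 * μ l) * s) * (r s * v (l, s)) with hB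
  -- This is v': when the split integral is differentiated, the two endpoint terms cancel.
  set k : ℝ → ℝ → ℝ := fun l x => -(Real.exp (2 * μ l * x) * B l x) with hk
  have hBi : ∀ l x, IntegrableOn (fun s => Real.exp (-(2 * μ l) * s) * (r s * v (l, s))) (Ioi x) :=
    fun l x => h.integrableOn_exp_mul (hvl l) (hMl l) (hμpos l) x
  have hBc : ∀ l, Continuous (B l) := fun l => continuous_integral_Ioi (hBi l)
  have hkc : ∀ l, Continuous (k l) := fun l => by
    have := hBc l
    simp only [hk]; fun_prop
  have hrm : ∀ l, Measurable fun s => r s * v (l, s) :=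
    fun l => h.measurable.mul (hvl l).measurable
  have hrc : ∀ l, ∀ x ∉ S, ContinuousAt (fun s => r s * v (l, s)) x := fun l x hx =>
    (continuousAt_const.sub (hqc x hx)).mul (hvl l).continuousAt
  have hexp : ∀ (c x : ℝ), HasDerivAt (fun x => Real.exp (c * x)) (c * Real.exp (c * x)) x :=
    fun c x => by simpa [mul_comm] using ((hasDerivAt_id x).const_mul c).exp
  have hB' : ∀ l, ∀ x ∉ S, HasDerivAt (B l) (-(Real.exp (-(2 * μ l) * x) * (r x * v (l, x)))) x :=
    fun l x hx => hasDerivAt_integral_Ioi ((Continuous.measurable (by fun_prop)).mul (hrm l))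
      (hBi l) ((Continuous.continuousAt (by fun_prop)).mul (hrc l x hx))
  have hcancel : ∀ l x, Real.exp (2 * μ l * x) * Real.exp (-(2 * μ l) * x) = 1 := fun l x => by
    rw [← Real.exp_add]; simp
  have hk' : ∀ l, ∀ x ∉ S, HasDerivAt (k l) (2 * μ l * k l x + r x * v (l, x)) x :=
    fun l x hx => by
      have := ((hexp (2 * μ l) x).mul (hB' l x hx)).neg
      refine this.congr_deriv ?_
      simp only [hk]
      linear_combination (r x * v (l, x)) * hcancel l x
  have hv'S : ∀ l, ∀ x ∉ S, HasDerivAt (fun s => v (l, s)) (k l x) x := fun l x hx => by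
    have h1 := hasDerivAt_integral_Ioi (hrm l) (h.integrableOn_mul (hvl l) (hMl l)) (hrc l x hx)
    have h2 := ((h1.sub ((hexp (2 * μ l) x).mul (hB' l x hx))).div_const (2 * μ l)).const_add 1
    have h3 : (fun s => v (l, s)) = fun x => 1 + ((∫ s in Ioi x, r s * v (l, s)) -
        Real.exp (2 * μ l * x) * B l x) / (2 * μ l) := by
      ext x
      rw [hfix l x, h.integral_kernel_eq (hvl l) (hMl l) l x]
    rw [h3]
    refine h2.congr_deriv ?_
    rw [div_eq_iff (by have := hμpos l; positivity)]
    simp only [hk]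
    linear_combination (r x * v (l, x)) * hcancel l x
  have hv' : ∀ l x, HasDerivAt (fun s => v (l, s)) (k l x) x := fun l =>
    hasDerivAt_of_hasDerivAt_off_countable hS (hvl l) (hkc l) (hv'S l)
  have hvb : ∀ l x, 0 ≤ x → |v (l, x)| ≤ M * jostWeight K κ μ₀ 0 := fun l x hx =>
    (hMl l x).trans (mul_le_mul_of_nonneg_left (h.weight_antitone hx) hM0)
  have hkb : ∀ l x, 0 ≤ x → |k l x| ≤ M * (μ₀ * (jostWeight K κ μ₀ 0 - 1)) := fun l x hx => by
    have h1 : |k l x| ≤ ∫ s in Ioi x, M * jostDensity K κ μ₀ s := by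
      simp only [hk, hB, abs_neg]
      rw [← integral_const_mul, ← Real.norm_eq_abs]
      refine norm_integral_le_of_norm_le ((h.integrableOn_density x).const_mul M) ?_
      refine (ae_restrict_iff' measurableSet_Ioi).2 (Eventually.of_forall fun s hs => ?_)
      rw [← mul_assoc, ← Real.exp_add, norm_mul, Real.norm_eq_abs, Real.abs_exp]
      refine le_trans (mul_le_of_le_one_left (norm_nonneg _) ?_) (h.abs_mul_le (hMl l s))
      have hs' : x < s := hs
      rw [Real.exp_le_one_iff]
      nlinarith [hμpos l]
    rw [integral_const_mul, h.integral_density] at h1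
    refine h1.trans ?_
    have := h.μ₀_pos
    have := h.weight_antitone hx
    gcongr
  refine ⟨fun l x => Real.exp (-μ l * x) * v (l, x),
    fun l x => Real.exp (-μ l * x) * (k l x - μ l * v (l, x)), ?_, ?_, ?_, ?_, ?_, ?_, ?_⟩
  · intro l _ x
    refine ((hexp (-μ l) x).mul (hv' l x)).congr_deriv ?_
    ring
  · intro l _
    have := hkc l
    have := hvl l
    fun_prop
  · intro l hl x hx
    refine ((hexp (-μ l) x).mul ((hk' l x hx).sub ((hv' l x).const_mul (μ l)))).congr_deriv ?_
    have := hμsq l hl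
    simp only [hr, Pi.sub_apply]
    linear_combination (Real.exp (-μ l * x) * v (l, x)) * this
  · have := h.continuous_μ
    exact Continuous.continuousOn (by fun_prop)
  · have hμc := h.continuous_μ
    have hB0 : Continuous fun l => B l 0 := by
      refine continuous_of_dominated (bound := fun s => M * jostDensity K κ μ₀ s) ?_ ?_
        ((h.integrableOn_density 0).const_mul M) ?_
      · exact fun l => ((Continuous.measurable (by fun_prop)).mul (hrm l)).aestronglyMeasurable
      · refine fun l => (ae_restrict_iff' measurableSet_Ioi).2 (Eventually.of_forall fun s hs => ?_)
        rw [norm_mul, Real.norm_eq_abs, Real.abs_exp]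
        refine le_trans (mul_le_of_le_one_left (norm_nonneg _) ?_) (h.abs_mul_le (hMl l s))
        have hs' : 0 < s := hs
        rw [Real.exp_le_one_iff]
        nlinarith [hμpos l]
      · exact Eventually.of_forall fun s => by fun_prop
    refine Continuous.continuousOn ?_
    simp only [hk]
    fun_prop
  · intro l hl
    refine ⟨M * (μ₀ * (jostWeight K κ μ₀ 0 - 1)) + (1 + μ l) * (M * jostWeight K κ μ₀ 0), μ l,
      hμpos l, fun x hx => ?_⟩
    have h1 := hvb l x hx
    have h2 := hkb l x hx
    have h3 := hμpos l
    have h4 : |μ l * v (l, x)| ≤ μ l * (M * jostWeight K κ μ₀ 0) := by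
      rw [abs_mul, abs_of_pos h3]; gcongr
    have h5 := abs_sub (k l x) (μ l * v (l, x))
    have h6 := abs_nonneg (v (l, x))
    have h7 := abs_nonneg (k l x)
    have h8 := abs_nonneg (μ l * v (l, x))
    constructor
    · rw [abs_mul, Real.abs_exp, mul_comm]
      refine mul_le_mul_of_nonneg_right ?_ (Real.exp_pos _).le
      linarith
    · rw [abs_mul, Real.abs_exp, mul_comm]
      refine mul_le_mul_of_nonneg_right ?_ (Real.exp_pos _).le
      linarith
  · intro l _
    -- The integral term in the fixed-point equation is bounded by this quantity, so v is positive
    -- once it drops below 1.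
    have h1 : Tendsto (fun x => M / 2 * (jostWeight K κ μ₀ x - 1)) atTop (𝓝 0) := by
      have := (h.tendsto_weight.sub_const 1).const_mul (M / 2)
      simpa using this
    filter_upwards [h1.eventually (gt_mem_nhds zero_lt_one)] with x hx
    refine mul_pos (Real.exp_pos _) ?_
    have h2 := h.abs_integral_le (hMl l) l x
    rw [hfix l x]
    have := (abs_lt.1 (h2.trans_lt hx)).1
    linarith

/-! ### Weak derivatives and square integrability -/

theorem intervalIntegrable_of_bounded {q : ℝ → ℝ} (hq : Measurable q) {K : ℝ}
    (hK : ∀ x, |q x| ≤ K) (a b : ℝ) : IntervalIntegrable q volume a b := by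
  refine (intervalIntegrable_const (c := K)).mono_fun hq.aestronglyMeasurable
    (Eventually.of_forall fun x => ?_)
  exact (hK x).trans (le_abs_self K)

theorem isWeakDeriv_of_hasDerivAt_off_countable {F F' : ℝ → ℝ} {S : Set ℝ} (hS : S.Countable)
    (hF : Continuous F) (hd : ∀ x ∉ S, HasDerivAt F (F' x) x)
    (hi : ∀ a b, IntervalIntegrable F' volume a b) : IsWeakDeriv F F' := by
  intro φ hφ hc
  obtain ⟨R, hR⟩ := hc.isCompact.isBounded.subset_ball (0 : ℝ)
  have hsub : ∀ x, φ x ≠ 0 → x ∈ Ioo (-R) R := fun x hx => by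
    have := hR (subset_tsupport φ hx)
    simpa [abs_lt] using this
  have hsub' : ∀ x, deriv φ x ≠ 0 → x ∈ Ioo (-R) R := fun x hx => by
    have := hR (support_deriv_subset hx)
    simpa [abs_lt] using this
  have hφd : ∀ x, HasDerivAt φ (deriv φ x) x := fun x =>
    (hφ.differentiable (by simp)).differentiableAt.hasDerivAt
  have hφc : Continuous (deriv φ) := hφ.continuous_deriv (by simp)
  have hi' : IntervalIntegrable (fun x => F x * deriv φ x) volume (-R) R :=
    (hF.mul hφc).intervalIntegrable _ _
  have h1 := integral_eq_of_hasDerivAt_off_countable (fun x => F x * φ x)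
    (fun x => F' x * φ x + F x * deriv φ x) hS (a := -R) (b := R)
    (hF.mul hφ.continuous).continuousOn (fun x hx => (hd x hx.2).mul (hφd x))
    (((hi _ _).mul_continuousOn hφ.continuous.continuousOn).add hi')
  have hR0 : φ R = 0 := by
    by_contra h; exact lt_irrefl _ (hsub R h).2
  have hR1 : φ (-R) = 0 := by
    by_contra h; exact lt_irrefl _ (hsub (-R) h).1
  rw [intervalIntegral.integral_add ((hi _ _).mul_continuousOn hφ.continuous.continuousOn) hi',
    hR0, hR1,
    intervalIntegral.integral_eq_integral_of_support_subset,
    intervalIntegral.integral_eq_integral_of_support_subset] at h1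
  · linarith
  · exact fun x hx => Ioo_subset_Ioc_self (hsub' x (right_ne_zero_of_mul hx))
  · exact fun x hx => Ioo_subset_Ioc_self (hsub x (right_ne_zero_of_mul hx))

theorem integrableOn_sq_of_le_exp {φ : ℝ → ℝ} (hφ : Continuous φ) {C ν : ℝ} (hν : 0 < ν)
    (hb : ∀ᶠ x in atTop, |φ x| ≤ C * Real.exp (-ν * x)) :
    IntegrableOn (fun x => φ x ^ 2) (Ioi 0) := by
  refine integrable_of_isBigO_exp_neg (a := 0) (b := 2 * ν) (by positivity)
    (hφ.pow 2).continuousOn ?_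
  refine Asymptotics.IsBigO.of_bound (C ^ 2) ?_
  filter_upwards [hb] with x hx
  rw [norm_pow, Real.norm_eq_abs, Real.norm_eq_abs, Real.abs_exp,
    show Real.exp (-(2 * ν) * x) = Real.exp (-ν * x) ^ 2 by
      rw [← Real.exp_nat_mul]; congr 1; push_cast; ring, ← mul_pow]
  gcongr

theorem memLp_two_of_le_exp {φ : ℝ → ℝ} (hφ : Continuous φ) {C ν C' ν' : ℝ} (hν : 0 < ν)
    (hν' : 0 < ν') (hb : ∀ᶠ x in atTop, |φ x| ≤ C * Real.exp (-ν * x))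
    (hb' : ∀ᶠ x in atTop, |φ (-x)| ≤ C' * Real.exp (-ν' * x)) : MemLp φ 2 := by
  rw [memLp_two_iff_integrable_sq hφ.aestronglyMeasurable, ← integrableOn_univ,
    ← Iic_union_Ioi (a := (0 : ℝ)), integrableOn_union, integrableOn_Iic_iff_integrableOn_Iio]
  refine ⟨?_, integrableOn_sq_of_le_exp hφ hν hb⟩
  have h1 := integrableOn_sq_of_le_exp (hφ.comp continuous_neg) hν' hb'
  rw [← (Measure.measurePreserving_neg (volume : Measure ℝ)).integrableOn_comp_preimage
    (Homeomorph.neg ℝ).measurableEmbedding]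
  simpa [Function.comp_def] using h1

/-! ### The Wronskian of two Jost families and its zeros -/

namespace IsJostFamily

variable {q : ℝ → ℝ} {S : Set ℝ} {f f' g g' : ℝ → ℝ → ℝ}

theorem continuous (h : IsJostFamily q S f f') {l : ℝ} (hl : 0 ≤ l) : Continuous (f l) :=
  continuous_iff_continuousAt.2 fun x => (h.hasDerivAt l hl x).continuousAt

theorem tendsto_zero (h : IsJostFamily q S f f') {l : ℝ} (hl : 0 ≤ l) :
    Tendsto (f l) atTop (𝓝 0) ∧ Tendsto (f' l) atTop (𝓝 0) := by
  obtain ⟨C, ν, hν, hb⟩ := h.decay l hl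
  have h1 : Tendsto (fun x : ℝ => C * Real.exp (-ν * x)) atTop (𝓝 0) := by
    simpa using (Real.tendsto_exp_atBot.comp
      (tendsto_id.const_mul_atTop_of_neg (neg_lt_zero.2 hν))).const_mul C
  constructor
  · refine squeeze_zero_norm' ?_ h1
    filter_upwards [eventually_ge_atTop 0] with x hx using (hb x hx).1
  · refine squeeze_zero_norm' ?_ h1
    filter_upwards [eventually_ge_atTop 0] with x hx using (hb x hx).2

/-- For l > sup |q| the product f f' has derivative (l - q) f² + f'² ≥ 0 and limit 0, so it is
nonpositive. A zero would make it vanish from there on, contradicting f > 0 near +∞. Hence f has no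
zero, and f' has the opposite sign. -/
theorem pos_and_deriv_neg (h : IsJostFamily q S f f') (hS : S.Countable) (hq : Measurable q)
    {K : ℝ} (hK : ∀ x, |q x| ≤ K) {l : ℝ} (hl : K < l) (x : ℝ) : 0 < f l x ∧ f' l x < 0 := by
  have hl0 : 0 ≤ l := ((abs_nonneg _).trans (hK 0)).trans hl.le
  have hf := h.continuous hl0
  have hf' := h.continuous_deriv l hl0
  have hlq : ∀ x, 0 < l - q x := fun x => by linarith [(abs_le.1 (hK x)).2]
  have hd : ∀ x ∉ S, HasDerivAt (fun x => f l x * f' l x)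
      ((l - q x) * (f l x ^ 2) + f' l x ^ 2) x := fun x hx =>
    ((h.hasDerivAt l hl0 x).mul (h.ode l hl0 x hx)).congr_deriv (by ring)
  have hmono : Monotone fun x => f l x * f' l x := by
    refine monotone_of_hasDerivAt_off_countable hS (hf.mul hf') hd (fun a b => ?_) fun x => ?_
    · refine IntervalIntegrable.add ?_ ((hf'.pow 2).intervalIntegrable a b)
      exact (intervalIntegrable_const.sub (intervalIntegrable_of_bounded hq hK a b)).mul_continuousOn
        (hf.pow 2).continuousOn
    · have := hlq x
      positivity
  have htend : Tendsto (fun x => f l x * f' l x) atTop (𝓝 0) := by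
    simpa using (h.tendsto_zero hl0).1.mul (h.tendsto_zero hl0).2
  have hneg : ∀ x, f l x * f' l x < 0 := fun x => by
    refine lt_of_le_of_ne (hmono.ge_of_tendsto htend x) fun h0 => ?_
    have hzero : ∀ y, x ≤ y → f l y * f' l y = 0 := fun y hy =>
      le_antisymm (hmono.ge_of_tendsto htend y) (h0.symm.le.trans (hmono hy))
    obtain ⟨R, hR⟩ := eventually_atTop.1 (h.eventually_pos l hl0)
    obtain ⟨y, hyS, hy⟩ := (hS.dense_compl ℝ).exists_mem_open (isOpen_Ioi (a := max x R))
      ⟨max x R + 1, by simp⟩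
    have hxy : x < y := (le_max_left _ _).trans_lt hy
    have hev : (fun x => f l x * f' l x) =ᶠ[𝓝 y] fun _ => 0 := by
      filter_upwards [lt_mem_nhds hxy] with z hz using hzero z hz.le
    have h2 := (hd y hyS).unique ((hasDerivAt_const y (0 : ℝ)).congr_of_eventuallyEq hev)
    have h3 := hR y ((le_max_right _ _).trans hy.le)
    have h4 := hlq y
    have : 0 < (l - q y) * (f l y ^ 2) := by positivity
    nlinarith [sq_nonneg (f' l y)]
  have hpos : ∀ x, 0 < f l x := fun x => by
    by_contra! hx
    obtain ⟨R, hR⟩ := eventually_atTop.1 (h.eventually_pos l hl0)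
    obtain ⟨z, -, hz⟩ := intermediate_value_Icc (le_max_left x R) hf.continuousOn
      ⟨hx, (hR (max x R) (le_max_right _ _)).le⟩
    have := hneg z
    rw [hz, zero_mul] at this
    exact lt_irrefl _ this
  exact ⟨hpos x, by have := hneg x; have := hpos x; nlinarith⟩

/-- The Wronskian of the Jost functions at `-∞` (the reflection of `g`) and at `+∞`. -/
theorem wronskian_eq (hf : IsJostFamily q S f f') (hg : IsJostFamily (fun x => q (-x)) S g g')
    (hS : S.Countable) (hsymm : ∀ x ∉ S, -x ∉ S) {l : ℝ} (hl : 0 ≤ l) (x y : ℝ) :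
    g l (-x) * f' l x + g' l (-x) * f l x = g l (-y) * f' l y + g' l (-y) * f l y := by
  have h1 := hf.continuous hl
  have h2 := hg.continuous hl
  have h3 := hf.continuous_deriv l hl
  have h4 := hg.continuous_deriv l hl
  refine eq_of_hasDerivAt_zero_off_countable
    (F := fun x => g l (-x) * f' l x + g' l (-x) * f l x) hS (by fun_prop) (fun z hz => ?_) x y
  have hgz : HasDerivAt (fun x => g l (-x)) (-g' l (-z)) z :=
    hasDerivAt_comp_neg_of_eq (hg.hasDerivAt l hl (-z)) rfl
  have hgz' : HasDerivAt (fun x => g' l (-x)) (-((l - q z) * g l (-z))) z :=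
    hasDerivAt_comp_neg_of_eq (hg.ode l hl (-z) (hsymm z hz)) (by rw [neg_neg])
  refine ((hgz.mul (hf.ode l hl z hz)).add (hgz'.mul (hf.hasDerivAt l hl z))).congr_deriv ?_
  ring

/-- If the Wronskian vanishes, the Jost function at `+∞` is near `-∞` a multiple of the Jost
function at `-∞`. -/
theorem exists_eventually_eq_mul (hf : IsJostFamily q S f f')
    (hg : IsJostFamily (fun x => q (-x)) S g g') {l : ℝ} (hl : 0 ≤ l)
    (hW : ∀ x, g l (-x) * f' l x + g' l (-x) * f l x = 0) :
    ∃ c, ∀ᶠ x in atTop, f l (-x) = c * g l x ∧ f' l (-x) = -(c * g' l x) := by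
  obtain ⟨R, hR⟩ := eventually_atTop.1 (hg.eventually_pos l hl)
  -- The numerator of the quotient's derivative is, up to sign, the Wronskian at -x.
  have hd : ∀ x ∈ Ioi R, HasDerivAt (fun x => f l (-x) / g l x) 0 x := fun x hx => by
    have hfx : HasDerivAt (fun x => f l (-x)) (-f' l (-x)) x :=
      hasDerivAt_comp_neg_of_eq (hf.hasDerivAt l hl (-x)) rfl
    have hgx := hR x hx.out.le
    refine (hfx.div (hg.hasDerivAt l hl x) hgx.ne').congr_deriv ?_
    have := hW (-x)
    rw [neg_neg] at this
    rw [div_eq_zero_iff]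
    left
    linarith
  obtain ⟨c, hc⟩ := isOpen_Ioi.exists_is_const_of_deriv_eq_zero isPreconnected_Ioi
    (fun x hx => (hd x hx).differentiableAt.differentiableWithinAt) (fun x hx => (hd x hx).deriv)
  refine ⟨c, ?_⟩
  filter_upwards [eventually_gt_atTop R] with x hx
  have hgx := hR x hx.le
  have h1 : f l (-x) = c * g l x := by rw [← hc x hx, div_mul_cancel₀ _ hgx.ne']
  refine ⟨h1, ?_⟩
  have := hW (-x)
  rw [neg_neg, h1] at this
  have h2 : g l x * (f' l (-x) + c * g' l x) = 0 := by linarith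
  rcases mul_eq_zero.1 h2 with h3 | h3
  · exact absurd h3 hgx.ne'
  · linarith

/-- The Wronskian is continuous in l, positive at 0 and negative at K + 1. At a zero Λ in between,
the Jost function at +∞ is also a multiple of the one at -∞ near -∞, so it decays at both ends. -/
theorem exists_eigenfunction (hf : IsJostFamily q S f f')
    (hg : IsJostFamily (fun x => q (-x)) S g g') (hS : S.Countable) (hsymm : ∀ x ∉ S, -x ∉ S)
    (hq : Measurable q) {K : ℝ} (hK : ∀ x, |q x| ≤ K)
    (hW : 0 < g 0 0 * f' 0 0 + g' 0 0 * f 0 0) :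
    ∃ Λ : ℝ, 0 < Λ ∧ ∃ Ψ Ψ₁ Ψ₂ : ℝ → ℝ, MemLp Ψ 2 ∧ MemLp Ψ₁ 2 ∧ MemLp Ψ₂ 2 ∧
      IsWeakDeriv Ψ Ψ₁ ∧ IsWeakDeriv Ψ₁ Ψ₂ ∧ ¬ (Ψ =ᵐ[volume] 0) ∧
      ∀ x, Ψ₂ x + q x * Ψ x = Λ * Ψ x := by
  have hK0 : 0 ≤ K := (abs_nonneg _).trans (hK 0)
  have hWK : g (K + 1) 0 * f' (K + 1) 0 + g' (K + 1) 0 * f (K + 1) 0 < 0 := by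
    obtain ⟨h1, h2⟩ := hf.pos_and_deriv_neg hS hq hK (lt_add_one K) 0
    obtain ⟨h3, h4⟩ := hg.pos_and_deriv_neg hS (hq.comp measurable_neg) (fun x => hK (-x))
      (lt_add_one K) 0
    nlinarith [mul_pos h3 (neg_pos.2 h2), mul_pos (neg_pos.2 h4) h1]
  have hWc : ContinuousOn (fun l => g l 0 * f' l 0 + g' l 0 * f l 0) (Icc 0 (K + 1)) :=
    ((hg.continuousOn_zero.mul hf.continuousOn_deriv_zero).add
      (hg.continuousOn_deriv_zero.mul hf.continuousOn_zero)).mono Icc_subset_Ici_self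
  obtain ⟨Λ, hΛ, hΛ0⟩ := intermediate_value_Icc' (by linarith) hWc ⟨hWK.le, hW.le⟩
  have hΛne : Λ ≠ 0 := by
    rintro rfl
    exact hW.ne' hΛ0
  have hl : 0 ≤ Λ := hΛ.1
  have hfc := hf.continuous hl
  have hfc' := hf.continuous_deriv Λ hl
  obtain ⟨c, hc⟩ := hf.exists_eventually_eq_mul hg hl fun x => by
    rw [hf.wronskian_eq hg hS hsymm hl x 0, neg_zero]
    exact hΛ0
  obtain ⟨C, ν, hν, hb⟩ := hf.decay Λ hl
  obtain ⟨C', ν', hν', hb'⟩ := hg.decay Λ hl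
  have hΨ : MemLp (f Λ) 2 := by
    refine memLp_two_of_le_exp (C := C) (C' := |c| * C') hfc hν hν' ?_ ?_
    · filter_upwards [eventually_ge_atTop 0] with x hx using (hb x hx).1
    · filter_upwards [eventually_ge_atTop 0, hc] with x hx hcx
      rw [hcx.1, abs_mul, mul_assoc]
      exact mul_le_mul_of_nonneg_left (hb' x hx).1 (abs_nonneg c)
  refine ⟨Λ, lt_of_le_of_ne hl hΛne.symm, f Λ, f' Λ, fun x => (Λ - q x) * f Λ x, hΨ, ?_, ?_, ?_,
    ?_, ?_, fun x => by ring⟩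
  · refine memLp_two_of_le_exp (C := C) (C' := |c| * C') hfc' hν hν' ?_ ?_
    · filter_upwards [eventually_ge_atTop 0] with x hx using (hb x hx).2
    · filter_upwards [eventually_ge_atTop 0, hc] with x hx hcx
      rw [hcx.2, abs_neg, abs_mul, mul_assoc]
      exact mul_le_mul_of_nonneg_left (hb' x hx).2 (abs_nonneg c)
  · refine (hΨ.const_mul (Λ + K)).of_le (Measurable.aestronglyMeasurable ?_)
      (Eventually.of_forall fun x => ?_)
    · exact (measurable_const.sub hq).mul hfc.measurable
    · rw [norm_mul, norm_mul]
      refine mul_le_mul_of_nonneg_right ?_ (norm_nonneg _)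
      rw [Real.norm_eq_abs, Real.norm_eq_abs, abs_of_nonneg (by linarith : 0 ≤ Λ + K)]
      refine (abs_sub _ _).trans ?_
      rw [abs_of_nonneg hl]
      linarith [hK x]
  · exact isWeakDeriv_of_hasDerivAt_off_countable countable_empty hfc
      (fun x _ => hf.hasDerivAt Λ hl x) fun a b => hfc'.intervalIntegrable a b
  · exact isWeakDeriv_of_hasDerivAt_off_countable hS hfc' (hf.ode Λ hl) fun a b =>
      (intervalIntegrable_const.sub (intervalIntegrable_of_bounded hq hK a b)).mul_continuousOn
        hfc.continuousOn
  · intro h0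
    have h1 : f Λ = 0 := (hfc.ae_eq_iff_eq volume continuous_zero).1 h0
    obtain ⟨x, hx⟩ := (hf.eventually_pos Λ hl).exists
    rw [h1] at hx
    exact lt_irrefl _ hx

end IsJostFamily

/-! ### Decaying solutions at l = 0 -/

/-- By the mean value theorem on [x, x + 1], P' takes the value P (x + 1) - P x → 0 at points
tending to +∞. -/
theorem eq_zero_of_tendsto_of_tendsto_deriv {P P' : ℝ → ℝ} {R a ℓ : ℝ}
    (hd : ∀ x, R < x → HasDerivAt P (P' x) x) (hP : Tendsto P atTop (𝓝 a))
    (hP' : Tendsto P' atTop (𝓝 ℓ)) : ℓ = 0 := by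
  have hex : ∀ x, ∃ y, x ≤ y ∧ (R < x → P' y = P (x + 1) - P x) := fun x => by
    by_cases hx : R < x
    · obtain ⟨y, hy, h1⟩ := exists_hasDerivAt_eq_slope P P' (lt_add_one x)
        (fun z hz => (hd z (hx.trans_le hz.1)).continuousAt.continuousWithinAt)
        (fun z hz => hd z (hx.trans hz.1))
      exact ⟨y, hy.1.le, fun _ => by simpa using h1⟩
    · exact ⟨x, le_rfl, fun h => absurd h hx⟩
  choose ξ hξ hξ' using hex
  have h1 : Tendsto (fun x => P' (ξ x)) atTop (𝓝 ℓ) := hP'.comp (tendsto_atTop_mono hξ tendsto_id)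
  have h2 : Tendsto (fun x => P (x + 1) - P x) atTop (𝓝 (a - a)) :=
    (hP.comp (tendsto_atTop_add_const_right _ 1 tendsto_id)).sub hP
  rw [sub_self] at h2
  refine tendsto_nhds_unique h1 (h2.congr' ?_)
  filter_upwards [eventually_gt_atTop R] with x hx using (hξ' x hx).symm

theorem exists_isMaxOn_Ici_of_tendsto_zero {P : ℝ → ℝ} {R : ℝ} (hc : ContinuousOn P (Ici R))
    (hpos : 0 < P R) (hP : Tendsto P atTop (𝓝 0)) : ∃ x ∈ Ici R, IsMaxOn P (Ici R) x := by
  obtain ⟨B, hB⟩ := eventually_atTop.1 (hP.eventually (gt_mem_nhds hpos))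
  obtain ⟨x, hx, hmax⟩ := isCompact_Icc.exists_isMaxOn (nonempty_Icc.2 (le_max_left R B))
    (hc.mono Icc_subset_Ici_self)
  refine ⟨x, hx.1, fun y hy => ?_⟩
  rcases le_total y (max R B) with h | h
  · exact hmax ⟨hy, h⟩
  · exact (hB y ((le_max_right _ _).trans h)).le.trans (hmax (left_mem_Icc.2 (le_max_left R B)))

/-- A positive solution of `P'' = -q P` that decays together with its derivative can exist only if
the exponentially attained limit of `q` is negative. -/
theorem limit_neg_of_pos_decaying_solution {q P P' : ℝ → ℝ} {R qe C κ : ℝ} (hκ : 0 < κ)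
    (hb : ∀ x, |q x - qe| ≤ C * Real.exp (-κ * x))
    (hP : ∀ x, R < x → HasDerivAt P (P' x) x)
    (hP' : ∀ x, R < x → HasDerivAt P' (-(q x * P x)) x)
    (hP0 : Tendsto P atTop (𝓝 0)) (hP0' : Tendsto P' atTop (𝓝 0))
    (hpos : ∀ᶠ x in atTop, 0 < P x) : qe < 0 := by
  by_contra! hqe
  have hC : 0 ≤ C := by simpa using (abs_nonneg _).trans (hb 0)
  have hexp0 : Tendsto (fun x : ℝ => Real.exp (-κ * x)) atTop (𝓝 0) :=
    Real.tendsto_exp_atBot.comp (tendsto_id.const_mul_atTop_of_neg (neg_lt_zero.2 hκ))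
  have hsmall : ∀ᶠ x in atTop, C / κ ^ 2 * Real.exp (-κ * x) < 1 := by
    have := hexp0.const_mul (C / κ ^ 2)
    rw [mul_zero] at this
    exact this.eventually (gt_mem_nhds zero_lt_one)
  obtain ⟨R₁, hR₁⟩ := eventually_atTop.1 (hsmall.and (hpos.and (eventually_gt_atTop R)))
  have hR : ∀ x, R₁ ≤ x → R < x := fun x hx => (hR₁ x hx).2.2
  obtain ⟨x₁, hx₁, hmax⟩ := exists_isMaxOn_Ici_of_tendsto_zero
    (fun x hx => (hP x (hR x hx)).continuousAt.continuousWithinAt) (hR₁ R₁ le_rfl).2.1 hP0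
  set m := P x₁ with hm
  have hm0 : 0 < m := (hR₁ x₁ hx₁).2.1
  have hexp : ∀ x : ℝ, HasDerivAt (fun x => Real.exp (-κ * x)) (-κ * Real.exp (-κ * x)) x :=
    fun x => by simpa [mul_comm] using ((hasDerivAt_id x).const_mul (-κ)).exp
  -- The correction contributes -C m e^{-κ x} to φ'', which absorbs -q P ≤ C m e^{-κ x} (from qe ≥ 0
  -- and 0 < P ≤ m). So φ' decreases to 0 and is nonnegative, φ increases to 0, and φ x₁ ≤ 0. But φ
  -- x₁ = m (1 - C / κ² e^{-κ x₁}) > 0 by the choice of R₁.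
  set φ : ℝ → ℝ := fun x => P x - C / κ ^ 2 * m * Real.exp (-κ * x) with hφ
  set φ' : ℝ → ℝ := fun x => P' x + C / κ * m * Real.exp (-κ * x) with hφ'
  have hφd : ∀ x, R₁ ≤ x → HasDerivAt φ (φ' x) x := fun x hx => by
    refine ((hP x (hR x hx)).sub ((hexp x).const_mul (C / κ ^ 2 * m))).congr_deriv ?_
    simp only [hφ']
    field_simp
    ring
  have hφd' : ∀ x, R₁ ≤ x → HasDerivAt φ' (-(q x * P x) - C * m * Real.exp (-κ * x)) x :=
    fun x hx => by
      refine ((hP' x (hR x hx)).add ((hexp x).const_mul (C / κ * m))).congr_deriv ?_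
      field_simp
      ring
  have hφ0 : Tendsto φ atTop (𝓝 0) := by
    simpa [hφ] using hP0.sub (hexp0.const_mul (C / κ ^ 2 * m))
  have hφ0' : Tendsto φ' atTop (𝓝 0) := by
    simpa [hφ'] using hP0'.add (hexp0.const_mul (C / κ * m))
  have hge : ∀ x ∈ Ici x₁, R₁ ≤ x := fun x hx => le_trans hx₁ hx
  have hanti : AntitoneOn φ' (Ici x₁) := by
    refine antitoneOn_of_deriv_nonpos (convex_Ici x₁)
      (fun x hx => (hφd' x (hge x hx)).continuousAt.continuousWithinAt)
      (fun x hx => (hφd' x (hge x (interior_subset hx))).differentiableAt.differentiableWithinAt)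
      fun x hx => ?_
    have hx' := hge x (interior_subset hx)
    rw [(hφd' x hx').deriv]
    have h1 : P x ≤ m := hmax hx'
    have h2 : 0 < P x := (hR₁ x hx').2.1
    have h3 := (abs_le.1 (hb x)).1
    have h4 : -(q x) ≤ C * Real.exp (-κ * x) := by linarith
    have h5 : -(q x) * P x ≤ C * Real.exp (-κ * x) * m := by
      refine (mul_le_mul_of_nonneg_right h4 h2.le).trans (mul_le_mul_of_nonneg_left h1 ?_)
      positivity
    linarith
  have hnn : ∀ x ∈ Ici x₁, 0 ≤ φ' x := fun x hx =>
    le_of_tendsto hφ0' ((eventually_ge_atTop x).mono fun y hy =>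
      hanti hx (le_trans (mem_Ici.1 hx) hy) hy)
  have hmono : MonotoneOn φ (Ici x₁) := by
    refine monotoneOn_of_deriv_nonneg (convex_Ici x₁)
      (fun x hx => (hφd x (hge x hx)).continuousAt.continuousWithinAt)
      (fun x hx => (hφd x (hge x (interior_subset hx))).differentiableAt.differentiableWithinAt)
      fun x hx => ?_
    rw [(hφd x (hge x (interior_subset hx))).deriv]
    exact hnn x (interior_subset hx)
  have hle : φ x₁ ≤ 0 := ge_of_tendsto hφ0 ((eventually_ge_atTop x₁).mono fun y hy =>
    hmono self_mem_Ici hy hy)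
  have h1 := (hR₁ x₁ hx₁).1
  simp only [hφ] at hle
  nlinarith

/-- The Wronskian of P with the Jost function is constant beyond R and tends to 0, so the Cauchy
data are proportional at a point x₁ where both are positive. Backward uniqueness carries this to R,
the edge of the region where the equation holds. -/
theorem IsJostFamily.exists_pos_eq_mul {q : ℝ → ℝ} {S : Set ℝ} {f f' : ℝ → ℝ → ℝ}
    (h : IsJostFamily q S f f') {K R : ℝ} (hK : ∀ x, |q x| ≤ K) (hS : ∀ x, R < x → x ∉ S)
    {P P' : ℝ → ℝ} (hPc : Continuous P) (hPc' : Continuous P')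
    (hP : ∀ x, R < x → HasDerivAt P (P' x) x)
    (hP' : ∀ x, R < x → HasDerivAt P' (-(q x * P x)) x)
    (hP0 : Tendsto P atTop (𝓝 0)) (hP0' : Tendsto P' atTop (𝓝 0))
    (hpos : ∀ᶠ x in atTop, 0 < P x) :
    ∃ c, 0 < c ∧ P R = c * f 0 R ∧ P' R = c * f' 0 R := by
  have hf := h.hasDerivAt 0 le_rfl
  have hf' : ∀ x, R < x → HasDerivAt (f' 0) (-(q x * f 0 x)) x := fun x hx =>
    (h.ode 0 le_rfl x (hS x hx)).congr_deriv (by ring)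
  have hfc := h.continuous le_rfl
  have hfc' := h.continuous_deriv 0 le_rfl
  obtain ⟨hf0, hf0'⟩ := h.tendsto_zero le_rfl
  have hW : ∀ x, R < x → P x * f' 0 x - P' x * f 0 x = 0 := by
    have hd : ∀ x ∈ Ioi R, HasDerivAt (fun x => P x * f' 0 x - P' x * f 0 x) 0 x := fun x hx =>
      (((hP x hx).mul (hf' x hx)).sub ((hP' x hx).mul (hf x))).congr_deriv (by ring)
    obtain ⟨a, ha⟩ := isOpen_Ioi.exists_is_const_of_deriv_eq_zero isPreconnected_Ioi
      (fun x hx => (hd x hx).differentiableAt.differentiableWithinAt) (fun x hx => (hd x hx).deriv)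
    have h1 : Tendsto (fun x => P x * f' 0 x - P' x * f 0 x) atTop (𝓝 0) := by
      simpa using (hP0.mul hf0').sub (hP0'.mul hf0)
    have h2 : a = 0 := by
      refine tendsto_nhds_unique (tendsto_const_nhds.congr' ?_) h1
      filter_upwards [eventually_gt_atTop R] with x hx using (ha x hx).symm
    exact fun x hx => (ha x hx).trans h2
  obtain ⟨x₁, hx₁, hPx, hfx⟩ :=
    ((eventually_gt_atTop R).and (hpos.and (h.eventually_pos 0 le_rfl))).exists
  set c := P x₁ / f 0 x₁ with hc
  have hc1 : P x₁ = c * f 0 x₁ := by rw [hc, div_mul_cancel₀ _ hfx.ne']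
  have hc2 : P' x₁ = c * f' 0 x₁ := by
    have := hW x₁ hx₁
    rw [hc1] at this
    have h2 : f 0 x₁ * (c * f' 0 x₁ - P' x₁) = 0 := by linarith
    rcases mul_eq_zero.1 h2 with h3 | h3
    · exact absurd h3 hfx.ne'
    · linarith
  -- Backward Grönwall: the rate 1 + K dominates |1 - q|, so the weighted energy of the difference
  -- is nondecreasing, and its vanishing at x₁ forces it to vanish at R.
  have hmono : MonotoneOn (fun x => ((P x - c * f 0 x) ^ 2 + (P' x - c * f' 0 x) ^ 2) *
      Real.exp ((1 + K) * x)) (Ici R) := by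
    have hexp : ∀ x : ℝ, HasDerivAt (fun x => Real.exp ((1 + K) * x))
        ((1 + K) * Real.exp ((1 + K) * x)) x :=
      fun x => by simpa [mul_comm] using ((hasDerivAt_id x).const_mul (1 + K)).exp
    have hd : ∀ x ∈ interior (Ici R), HasDerivAt
        (fun x => ((P x - c * f 0 x) ^ 2 + (P' x - c * f' 0 x) ^ 2) * Real.exp ((1 + K) * x))
        ((2 * (1 - q x) * ((P x - c * f 0 x) * (P' x - c * f' 0 x)) +
          (1 + K) * ((P x - c * f 0 x) ^ 2 + (P' x - c * f' 0 x) ^ 2)) *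
          Real.exp ((1 + K) * x)) x := fun x hx => by
      rw [interior_Ici] at hx
      have h1 := ((hP x hx).sub ((hf x).const_mul c)).pow 2
      have h2 := ((hP' x hx).sub ((hf' x hx).const_mul c)).pow 2
      refine ((h1.add h2).mul (hexp x)).congr_deriv ?_
      simp only [Pi.add_apply, Pi.pow_apply, Pi.sub_apply]
      push_cast
      ring
    refine monotoneOn_of_deriv_nonneg (convex_Ici R) (Continuous.continuousOn (by fun_prop))
      (fun x hx => (hd x hx).differentiableAt.differentiableWithinAt) fun x hx => ?_
    rw [(hd x hx).deriv]
    refine mul_nonneg ?_ (Real.exp_pos _).le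
    have h1 := abs_le.1 (hK x)
    set a := P x - c * f 0 x
    set b := P' x - c * f' 0 x
    nlinarith [mul_nonneg (by linarith : 0 ≤ K + q x) (sq_nonneg (a - b)),
      mul_nonneg (by linarith : 0 ≤ K - q x) (sq_nonneg (a + b)), sq_nonneg (a + b),
      sq_nonneg (a - b)]
  have hE := hmono self_mem_Ici hx₁.le hx₁.le
  simp only [hc1, hc2, sub_self] at hE
  have hE' : (P R - c * f 0 R) ^ 2 + (P' R - c * f' 0 R) ^ 2 ≤ 0 := by
    by_contra! hlt
    have := mul_pos hlt (Real.exp_pos ((1 + K) * R))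
    norm_num at hE
    linarith
  refine ⟨c, div_pos hPx hfx, ?_, ?_⟩
  · have : P R - c * f 0 R = 0 := by
      nlinarith [sq_nonneg (P R - c * f 0 R), sq_nonneg (P' R - c * f' 0 R)]
    linarith
  · have : P' R - c * f' 0 R = 0 := by
      nlinarith [sq_nonneg (P R - c * f 0 R), sq_nonneg (P' R - c * f' 0 R)]
    linarith

/-! ### Exponential convergence, smoothness of the potentials, eventual signs -/

/-- The functions u ± (C / κ) e^{-κ x} are monotone in opposite directions with common limit a, so
they enclose a. -/
theorem abs_sub_le_of_abs_deriv_le_exp {u p : ℝ → ℝ} {a C κ : ℝ} (hκ : 0 < κ)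
    (hd : ∀ x, HasDerivAt u (p x) x) (hp : ∀ x, 0 ≤ x → |p x| ≤ C * Real.exp (-κ * x))
    (hu : Tendsto u atTop (𝓝 a)) {x : ℝ} (hx : 0 ≤ x) :
    |u x - a| ≤ C / κ * Real.exp (-κ * x) := by
  have hexp0 : Tendsto (fun x : ℝ => C / κ * Real.exp (-κ * x)) atTop (𝓝 0) := by
    simpa using (Real.tendsto_exp_atBot.comp
      (tendsto_id.const_mul_atTop_of_neg (neg_lt_zero.2 hκ))).const_mul (C / κ)
  have hexp : ∀ x : ℝ, HasDerivAt (fun x => C / κ * Real.exp (-κ * x))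
      (-(C * Real.exp (-κ * x))) x := fun x => by
    refine (((hasDerivAt_id x).const_mul (-κ)).exp.const_mul (C / κ)).congr_deriv ?_
    simp only [id]
    field_simp
  have h1 : AntitoneOn (fun x => u x + C / κ * Real.exp (-κ * x)) (Ici 0) := by
    have hd1 := fun x => (hd x).add (hexp x)
    refine antitoneOn_of_deriv_nonpos (convex_Ici 0)
      (fun x _ => (hd1 x).continuousAt.continuousWithinAt)
      (fun x _ => (hd1 x).differentiableAt.differentiableWithinAt) fun x hx => ?_
    refine (hd1 x).deriv.le.trans ?_
    linarith [(abs_le.1 (hp x (interior_subset hx))).2]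
  have h2 : MonotoneOn (fun x => u x - C / κ * Real.exp (-κ * x)) (Ici 0) := by
    have hd1 := fun x => (hd x).sub (hexp x)
    refine monotoneOn_of_deriv_nonneg (convex_Ici 0)
      (fun x _ => (hd1 x).continuousAt.continuousWithinAt)
      (fun x _ => (hd1 x).differentiableAt.differentiableWithinAt) fun x hx => ?_
    refine le_trans ?_ (hd1 x).deriv.ge
    linarith [(abs_le.1 (hp x (interior_subset hx))).1]
  have h3 : a ≤ u x + C / κ * Real.exp (-κ * x) := by
    have := hu.add hexp0
    rw [add_zero] at this
    exact le_of_tendsto this ((eventually_ge_atTop x).mono fun y hy => h1 hx (hx.trans hy) hy)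
  have h4 : u x - C / κ * Real.exp (-κ * x) ≤ a := by
    have := hu.sub hexp0
    rw [sub_zero] at this
    exact ge_of_tendsto this ((eventually_ge_atTop x).mono fun y hy => h2 hx (hx.trans hy) hy)
  rw [abs_le]
  constructor <;> linarith

section ContDiffThree

variable {W : ℝ → ℝ}

theorem ContDiff.hasDerivAt_of_three (hW : ContDiff ℝ 3 W) (w : ℝ) :
    HasDerivAt W (deriv W w) w :=
  (hW.differentiable (by norm_num)).differentiableAt.hasDerivAt

theorem ContDiff.deriv_of_three (hW : ContDiff ℝ 3 W) : ContDiff ℝ 2 (deriv W) :=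
  ((contDiff_succ_iff_deriv (n := 2)).1 (hW.of_le (by norm_num))).2.2

theorem ContDiff.deriv_deriv_of_three (hW : ContDiff ℝ 3 W) : ContDiff ℝ 1 (deriv (deriv W)) :=
  ((contDiff_succ_iff_deriv (n := 1)).1 (hW.deriv_of_three.of_le (by norm_num))).2.2

theorem ContDiff.hasDerivAt_deriv_of_three (hW : ContDiff ℝ 3 W) (w : ℝ) :
    HasDerivAt (deriv W) (deriv (deriv W) w) w :=
  (hW.deriv_of_three.differentiable (by norm_num)).differentiableAt.hasDerivAt

end ContDiffThree

/-- A `C¹` function is Lipschitz on bounded intervals. -/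
theorem ContDiff.exists_abs_sub_le {W : ℝ → ℝ} (hW : ContDiff ℝ 1 W) (B : ℝ) :
    ∃ K, 0 ≤ K ∧ ∀ a b, |a| ≤ B → |b| ≤ B → |W a - W b| ≤ K * |a - b| := by
  have hd : Differentiable ℝ W := hW.differentiable (by norm_num)
  have hc : Continuous (deriv W) := hW.continuous_deriv (by norm_num)
  obtain ⟨K, hK⟩ := isCompact_Icc.exists_bound_of_continuousOn (s := Icc (-B) B) hc.continuousOn
  refine ⟨max K 0, le_max_right _ _, fun a b ha hb => ?_⟩
  exact (convex_Icc (-B) B).norm_image_sub_le_of_norm_deriv_le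
    (fun x _ => hd.differentiableAt) (fun x hx => (hK x hx).trans (le_max_left _ _))
    (abs_le.1 hb) (abs_le.1 ha)

theorem Continuous.exists_abs_le_of_abs_le {W : ℝ → ℝ} (hW : Continuous W) (B : ℝ) :
    ∃ K, 0 ≤ K ∧ ∀ a, |a| ≤ B → |W a| ≤ K := by
  obtain ⟨K, hK⟩ := isCompact_Icc.exists_bound_of_continuousOn (s := Icc (-B) B) hW.continuousOn
  exact ⟨max K 0, le_max_right _ _, fun a ha => (hK a (abs_le.1 ha)).trans (le_max_left _ _)⟩

theorem eventually_pos_or_neg_of_eventually_ne_zero {p : ℝ → ℝ} (hp : Continuous p)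
    (h : ∀ᶠ x in atTop, p x ≠ 0) :
    ∃ σ : ℝ, (σ = 1 ∨ σ = -1) ∧ ∀ᶠ x in atTop, 0 < σ * p x := by
  obtain ⟨R, hR⟩ := eventually_atTop.1 h
  have key : ∀ x y, R ≤ x → x ≤ y → 0 < p x * p y := fun x y hx hxy => by
    by_contra! hle
    have hne : ∀ z ∈ Icc x y, p z ≠ 0 := fun z hz => hR z (hx.trans hz.1)
    rcases lt_or_gt_of_ne (hR x hx) with h1 | h1
    · obtain ⟨z, hz, h0⟩ := intermediate_value_Icc hxy hp.continuousOn
        (⟨h1.le, by nlinarith⟩ : (0 : ℝ) ∈ Icc (p x) (p y))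
      exact hne z hz h0
    · obtain ⟨z, hz, h0⟩ := intermediate_value_Icc' hxy hp.continuousOn
        (⟨by nlinarith, h1.le⟩ : (0 : ℝ) ∈ Icc (p y) (p x))
      exact hne z hz h0
  rcases lt_or_gt_of_ne (hR R le_rfl) with h1 | h1
  · refine ⟨-1, Or.inr rfl, ?_⟩
    filter_upwards [eventually_ge_atTop R] with x hx
    have := key R x le_rfl hx
    nlinarith
  · refine ⟨1, Or.inl rfl, ?_⟩
    filter_upwards [eventually_ge_atTop R] with x hx
    have := key R x le_rfl hx
    nlinarith

/-! ### Stationary fronts and their linearisation -/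

namespace PiecewisePotential

variable (V : PiecewisePotential) {L x : ℝ} (w : ℝ)

/-- The potential with the left and right intervals interchanged. -/
def swap : PiecewisePotential :=
  ⟨V.Vr, V.Vm, V.Vl, V.contDiff_r, V.contDiff_m, V.contDiff_l⟩

theorem du_middle (h1 : -L ≤ x) (h2 : x ≤ L) : V.du L w x = deriv V.Vm w := by
  simp [du, val, not_lt.2 h1, h2]

theorem du_right (hL : 0 < L) (hx : L < x) : V.du L w x = deriv V.Vr w := by
  have h1 : ¬ x < -L := by linarith
  simp [du, val, h1, not_le.2 hx]

theorem duu_eq : V.duu L w x = if x < -L then deriv (deriv V.Vl) w else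
    if x ≤ L then deriv (deriv V.Vm) w else deriv (deriv V.Vr) w := by
  unfold duu val
  split_ifs <;> simp [iteratedDeriv_succ, iteratedDeriv_zero]

theorem swap_val (hL : 0 < L) : V.swap.val L w x = V.val L w (-x) := by
  unfold val swap
  simp only
  split_ifs <;> first | rfl | linarith

theorem swap_du (hL : 0 < L) : V.swap.du L w x = V.du L w (-x) := by
  simp only [du, swap_val V _ hL]

theorem swap_duu (hL : 0 < L) : V.swap.duu L w x = V.duu L w (-x) := by
  simp only [duu, swap_val V _ hL]

end PiecewisePotential

namespace IsStationaryFront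

variable {V : PiecewisePotential} {L um up : ℝ} {u : ℝ → ℝ}

theorem hasDerivAt (h : IsStationaryFront V L um up u) (x : ℝ) : HasDerivAt u (deriv u x) x :=
  (h.contDiff.differentiable (by norm_num)).differentiableAt.hasDerivAt

theorem continuous_deriv (h : IsStationaryFront V L um up u) : Continuous (deriv u) :=
  h.contDiff.continuous_deriv (by norm_num)

theorem deriv_comp_neg (h : IsStationaryFront V L um up u) (x : ℝ) :
    deriv (fun x => u (-x)) x = -deriv u (-x) :=
  (hasDerivAt_comp_neg_of_eq (h.hasDerivAt (-x)) rfl).deriv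

/-- This reduces every statement about -∞ and -L to one about +∞ and L. -/
theorem reflect (h : IsStationaryFront V L um up u) (hL : 0 < L) :
    IsStationaryFront V.swap L up um (fun x => u (-x)) where
  contDiff := h.contDiff.comp contDiff_neg
  ode := fun x h1 h2 => by
    have h3 := h.ode (-x) (fun h => h2 (by linarith)) (fun h => h1 (by linarith))
    rw [funext h.deriv_comp_neg, V.swap_du _ hL]
    exact (hasDerivAt_comp_neg_of_eq h3 rfl).neg.congr_deriv (by ring)
  decay := by
    obtain ⟨C, κ, hκ, hb⟩ := h.decay
    refine ⟨C, κ, hκ, fun x => ?_⟩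
    rw [h.deriv_comp_neg, abs_neg, ← abs_neg x]
    exact hb (-x)
  tendsto_atBot := h.tendsto_atTop.comp tendsto_neg_atBot_atTop
  tendsto_atTop := h.tendsto_atBot.comp tendsto_neg_atTop_atBot

theorem exists_abs_sub_le_exp (h : IsStationaryFront V L um up u) :
    ∃ C κ : ℝ, 0 ≤ C ∧ 0 < κ ∧ ∀ x, 0 ≤ x → |u x - up| ≤ C * Real.exp (-κ * x) := by
  obtain ⟨C, κ, hκ, hb⟩ := h.decay
  have hC : 0 ≤ C := by simpa using (abs_nonneg _).trans (hb 0)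
  refine ⟨C / κ, κ, by positivity, hκ, fun x hx => abs_sub_le_of_abs_deriv_le_exp hκ h.hasDerivAt
    (fun y hy => ?_) h.tendsto_atTop hx⟩
  simpa [abs_of_nonneg hy] using hb y

theorem exists_abs_le (h : IsStationaryFront V L um up u) (hL : 0 < L) :
    ∃ B, |um| ≤ B ∧ |up| ≤ B ∧ ∀ x, |u x| ≤ B := by
  obtain ⟨C, κ, hC, hκ, hb⟩ := h.exists_abs_sub_le_exp
  obtain ⟨C', κ', hC', hκ', hb'⟩ := (h.reflect hL).exists_abs_sub_le_exp
  have key : ∀ {C κ x : ℝ}, 0 ≤ C → 0 < κ → 0 ≤ x → C * Real.exp (-κ * x) ≤ C :=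
    fun hC hκ hx => mul_le_of_le_one_right hC (Real.exp_le_one_iff.2 (by nlinarith))
  refine ⟨|um| + |up| + C + C', by linarith [abs_nonneg up], by linarith [abs_nonneg um],
    fun x => ?_⟩
  rcases le_total 0 x with hx | hx
  · have h1 := (hb x hx).trans (key hC hκ hx)
    have h2 := abs_add_le (u x - up) up
    rw [sub_add_cancel] at h2
    linarith [abs_nonneg um]
  · have h1 := (hb' (-x) (by linarith)).trans (key hC' hκ' (by linarith))
    rw [neg_neg] at h1
    have h2 := abs_add_le (u x - um) um
    rw [sub_add_cancel] at h2
    linarith [abs_nonneg up]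

theorem exists_abs_duu_le (h : IsStationaryFront V L um up u) (hL : 0 < L) :
    ∃ K, 0 ≤ K ∧ |deriv (deriv V.Vr) up| ≤ K ∧ ∀ x, |V.duu L (u x) x| ≤ K := by
  obtain ⟨B, -, hB, hu⟩ := h.exists_abs_le hL
  obtain ⟨K₁, h1, hK₁⟩ := V.contDiff_l.deriv_deriv_of_three.continuous.exists_abs_le_of_abs_le B
  obtain ⟨K₂, h2, hK₂⟩ := V.contDiff_m.deriv_deriv_of_three.continuous.exists_abs_le_of_abs_le B
  obtain ⟨K₃, h3, hK₃⟩ := V.contDiff_r.deriv_deriv_of_three.continuous.exists_abs_le_of_abs_le B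
  refine ⟨K₁ + K₂ + K₃, by positivity, (hK₃ up hB).trans (by linarith), fun x => ?_⟩
  rw [V.duu_eq]
  split_ifs
  · exact (hK₁ _ (hu x)).trans (by linarith)
  · exact (hK₂ _ (hu x)).trans (by linarith)
  · exact (hK₃ _ (hu x)).trans (by linarith)

theorem measurable_duu (h : IsStationaryFront V L um up u) :
    Measurable fun x => V.duu L (u x) x := by
  simp only [V.duu_eq]
  have hu := h.contDiff.continuous
  exact Measurable.ite measurableSet_Iio
    (V.contDiff_l.deriv_deriv_of_three.continuous.comp hu).measurable
    (Measurable.ite measurableSet_Iic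
      (V.contDiff_m.deriv_deriv_of_three.continuous.comp hu).measurable
      (V.contDiff_r.deriv_deriv_of_three.continuous.comp hu).measurable)

theorem continuousAt_duu (h : IsStationaryFront V L um up u) {x : ℝ}
    (hx : x ∉ ({-L, L} : Set ℝ)) : ContinuousAt (fun x => V.duu L (u x) x) x := by
  simp only [mem_insert_iff, mem_singleton_iff, not_or] at hx
  have hu := h.contDiff.continuous
  have h1 := V.contDiff_l.deriv_deriv_of_three.continuous.comp hu
  have h2 := V.contDiff_m.deriv_deriv_of_three.continuous.comp hu
  have h3 := V.contDiff_r.deriv_deriv_of_three.continuous.comp hu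
  simp only [V.duu_eq]
  rcases lt_or_gt_of_ne hx.1 with ha | ha
  · refine h1.continuousAt.congr ?_
    filter_upwards [gt_mem_nhds ha] with y hy
    simp [hy]
  rcases lt_or_gt_of_ne hx.2 with hb | hb
  · refine h2.continuousAt.congr ?_
    filter_upwards [lt_mem_nhds ha, gt_mem_nhds hb] with y hy hy'
    simp [not_lt.2 hy.le, hy'.le]
  · refine h3.continuousAt.congr ?_
    filter_upwards [lt_mem_nhds ha, lt_mem_nhds hb] with y hy hy'
    simp [not_lt.2 hy.le, not_le.2 hy']

theorem exists_abs_duu_sub_le_exp (h : IsStationaryFront V L um up u) (hL : 0 < L) :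
    ∃ C κ : ℝ, 0 < κ ∧ ∀ x, |V.duu L (u x) x - deriv (deriv V.Vr) up| ≤
      C * Real.exp (-κ * x) := by
  obtain ⟨C, κ, hC, hκ, hb⟩ := h.exists_abs_sub_le_exp
  obtain ⟨B, -, hB, hu⟩ := h.exists_abs_le hL
  obtain ⟨K, hK, hlip⟩ := V.contDiff_r.deriv_deriv_of_three.exists_abs_sub_le B
  obtain ⟨M, hM, hMr, hMq⟩ := h.exists_abs_duu_le hL
  -- The first term serves x > L, by the Lipschitz bound. The second serves x ≤ L, where e^{κ (L -
  -- x)} ≥ 1 and the trivial bound 2 M suffices.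
  refine ⟨K * C + 2 * M * Real.exp (κ * L), κ, hκ, fun x => ?_⟩
  rcases lt_or_ge L x with hx | hx
  · have h1 : ¬ x < -L := by linarith
    rw [V.duu_eq, if_neg h1, if_neg (not_le.2 hx), add_mul]
    refine (hlip _ _ (hu x) hB).trans ?_
    have h2 := mul_le_mul_of_nonneg_left (hb x (hL.trans hx).le) hK
    have h3 : 0 ≤ 2 * M * Real.exp (κ * L) * Real.exp (-κ * x) := by positivity
    linarith
  · rw [add_mul]
    refine (abs_sub _ _).trans ?_
    have h2 : 1 ≤ Real.exp (κ * L) * Real.exp (-κ * x) := by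
      rw [← Real.exp_add, Real.one_le_exp_iff]
      nlinarith
    have h3 : 0 ≤ K * C * Real.exp (-κ * x) := by positivity
    have h4 := hMq x
    nlinarith

theorem tendsto_deriv_atTop (h : IsStationaryFront V L um up u) :
    Tendsto (deriv u) atTop (𝓝 0) := by
  obtain ⟨C, κ, hκ, hb⟩ := h.decay
  have h1 : Tendsto (fun x : ℝ => C * Real.exp (-κ * x)) atTop (𝓝 0) := by
    simpa using (Real.tendsto_exp_atBot.comp
      (tendsto_id.const_mul_atTop_of_neg (neg_lt_zero.2 hκ))).const_mul C
  refine squeeze_zero_norm' ?_ h1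
  filter_upwards [eventually_ge_atTop 0] with x hx
  simpa [abs_of_nonneg hx] using hb x

theorem hasDerivAt_deriv_right (h : IsStationaryFront V L um up u) (hL : 0 < L) {x : ℝ}
    (hx : L < x) : HasDerivAt (deriv u) (-(deriv V.Vr (u x))) x := by
  rw [← V.du_right (u x) hL hx]
  exact h.ode x (by linarith) hx.ne'

/-- Energy is conserved on (L, ∞) and u_x → 0. Hence the phase point at L lies on an energy curve
fixed by `up` alone, the same for all fronts of a length curve. -/
theorem hamiltonian_right (h : IsStationaryFront V L um up u) (hL : 0 < L) :
    deriv u L ^ 2 / 2 + V.Vr (u L) = V.Vr up := by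
  have hr := V.contDiff_r
  set H : ℝ → ℝ := fun x => deriv u x ^ 2 / 2 + V.Vr (u x) with hH
  have hHc : Continuous H := by
    have := h.continuous_deriv
    have := hr.continuous.comp h.contDiff.continuous
    simp only [hH]
    fun_prop
  have hd : ∀ x ∈ Ioi L, HasDerivAt H 0 x := fun x hx => by
    have h1 := ((h.hasDerivAt_deriv_right hL hx).pow 2).div_const 2
    have h2 := (hr.hasDerivAt_of_three (u x)).comp x (h.hasDerivAt x)
    refine (h1.add h2).congr_deriv ?_
    push_cast
    ring
  obtain ⟨a, ha⟩ := isOpen_Ioi.exists_is_const_of_deriv_eq_zero isPreconnected_Ioi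
    (fun x hx => (hd x hx).differentiableAt.differentiableWithinAt) (fun x hx => (hd x hx).deriv)
  have h1 : Tendsto H atTop (𝓝 (V.Vr up)) := by
    have h2 := ((h.tendsto_deriv_atTop.pow 2).div_const 2).add
      ((hr.continuous.tendsto up).comp h.tendsto_atTop)
    simpa using h2
  have h2 : a = V.Vr up := by
    refine tendsto_nhds_unique (tendsto_const_nhds.congr' ?_) h1
    filter_upwards [eventually_gt_atTop L] with x hx using (ha x hx).symm
  have h3 : Tendsto H (𝓝[>] L) (𝓝 (H L)) := hHc.continuousAt.tendsto.mono_left nhdsWithin_le_nhds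
  refine tendsto_nhds_unique h3 (tendsto_const_nhds.congr' ?_)
  filter_upwards [self_mem_nhdsWithin] with x hx
  rw [ha x hx, h2]

/-- Near `+∞`, the derivative of the front is a multiple of the Jost function of the
linearisation at `0`. -/
theorem exists_isJostFamily (h : IsStationaryFront V L um up u) (hL : 0 < L) {σ : ℝ}
    (hpos : ∀ᶠ x in atTop, 0 < σ * deriv u x) :
    ∃ f f' : ℝ → ℝ → ℝ, IsJostFamily (fun x => V.duu L (u x) x) {-L, L} f f' ∧
      ∃ c, 0 < c ∧ σ * deriv u L = c * f 0 L ∧ -(σ * deriv V.Vr (u L)) = c * f' 0 L := by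
  obtain ⟨C, κ, hκ, hb⟩ := h.exists_abs_duu_sub_le_exp hL
  obtain ⟨K, -, -, hK⟩ := h.exists_abs_duu_le hL
  have hu := h.contDiff.continuous
  have hp := h.continuous_deriv
  have hV' := V.contDiff_r.deriv_of_three.continuous
  have hP : ∀ x, L < x → HasDerivAt (fun x => σ * deriv u x) (-(σ * deriv V.Vr (u x))) x :=
    fun x hx => ((h.hasDerivAt_deriv_right hL hx).const_mul σ).congr_deriv (by ring)
  have hP' : ∀ x, L < x → HasDerivAt (fun x => -(σ * deriv V.Vr (u x)))
      (-(V.duu L (u x) x * (σ * deriv u x))) x := fun x hx => by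
    have h1 : ¬ x < -L := by linarith
    rw [V.duu_eq, if_neg h1, if_neg (not_le.2 hx)]
    have h2 := (V.contDiff_r.hasDerivAt_deriv_of_three (u x)).comp x (h.hasDerivAt x)
    exact (h2.const_mul σ).neg.congr_deriv (by ring)
  have hP0 : Tendsto (fun x => σ * deriv u x) atTop (𝓝 0) := by
    simpa using h.tendsto_deriv_atTop.const_mul σ
  have hP0' : Tendsto (fun x => -(σ * deriv V.Vr (u x))) atTop (𝓝 0) := by
    have h1 := (((hV'.tendsto up).comp h.tendsto_atTop).const_mul σ).neg
    -- The limit of u_xx must vanish, so `up` is a critical point of V_r, unless σ = 0.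
    have h2 := eq_zero_of_tendsto_of_tendsto_deriv hP hP0 h1
    rw [h2] at h1
    exact h1
  -- Hyperbolicity, V_r''(up) < 0, is a consequence of the decaying one-signed u_x.
  have hneg := limit_neg_of_pos_decaying_solution hκ hb hP hP' hP0 hP0' hpos
  obtain ⟨f, f', hf⟩ := _root_.exists_isJostFamily (S := {-L, L}) (Set.to_countable _)
    h.measurable_duu (fun x hx => h.continuousAt_duu hx) hneg hκ hb
  have hS : ∀ x, L < x → x ∉ ({-L, L} : Set ℝ) := fun x hx => by
    simp only [mem_insert_iff, mem_singleton_iff, not_or]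
    exact ⟨by linarith, hx.ne'⟩
  exact ⟨f, f', hf, hf.exists_pos_eq_mul hK hS (by fun_prop) (by fun_prop) hP hP' hP0 hP0' hpos⟩

end IsStationaryFront

/-! ### Comparison of nearby orbits in the middle interval -/

theorem energy_le_of_second_order {w w' a : ℝ → ℝ} {K T : ℝ} (hK : 0 ≤ K) (hT : 0 ≤ T)
    (hwc : Continuous w) (hwc' : Continuous w')
    (hw : ∀ t ∈ Ioo 0 T, HasDerivAt w (w' t) t) (hw' : ∀ t ∈ Ioo 0 T, HasDerivAt w' (a t) t)
    (ha : ∀ t ∈ Ioo 0 T, |a t| ≤ K * |w t|) :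
    w T ^ 2 + w' T ^ 2 ≤ (w 0 ^ 2 + w' 0 ^ 2) * Real.exp ((1 + K) * T) := by
  have hd : ∀ t ∈ interior (Icc 0 T), HasDerivAt
      (fun t => (w t ^ 2 + w' t ^ 2) * Real.exp (-(1 + K) * t))
      ((2 * w t * w' t + 2 * w' t * a t - (1 + K) * (w t ^ 2 + w' t ^ 2)) *
        Real.exp (-(1 + K) * t)) t := fun t ht => by
    rw [interior_Icc] at ht
    have hexp : HasDerivAt (fun x => Real.exp (-(1 + K) * x))
        (-(1 + K) * Real.exp (-(1 + K) * t)) t := by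
      simpa [mul_comm] using ((hasDerivAt_id t).const_mul (-(1 + K))).exp
    refine ((((hw t ht).pow 2).add ((hw' t ht).pow 2)).mul hexp).congr_deriv ?_
    simp only [Pi.add_apply, Pi.pow_apply]
    push_cast
    ring
  have hanti : AntitoneOn (fun t => (w t ^ 2 + w' t ^ 2) * Real.exp (-(1 + K) * t)) (Icc 0 T) := by
    refine antitoneOn_of_deriv_nonpos (convex_Icc 0 T) (Continuous.continuousOn (by fun_prop))
      (fun t ht => (hd t ht).differentiableAt.differentiableWithinAt) fun t ht => ?_
    rw [(hd t ht).deriv]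
    refine mul_nonpos_of_nonpos_of_nonneg ?_ (Real.exp_pos _).le
    rw [interior_Icc] at ht
    have h1 : w' t * a t ≤ K * (|w' t| * |w t|) := by
      calc w' t * a t ≤ |w' t * a t| := le_abs_self _
        _ = |w' t| * |a t| := abs_mul _ _
        _ ≤ |w' t| * (K * |w t|) := mul_le_mul_of_nonneg_left (ha t ht) (abs_nonneg _)
        _ = _ := by ring
    have h2 : 2 * (|w' t| * |w t|) ≤ w t ^ 2 + w' t ^ 2 := by
      rw [← sq_abs (w t), ← sq_abs (w' t)]
      nlinarith [sq_nonneg (|w t| - |w' t|)]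
    nlinarith [sq_nonneg (w t - w' t), mul_le_mul_of_nonneg_left h2 hK]
  have h1 := hanti (left_mem_Icc.2 hT) (right_mem_Icc.2 hT) hT
  simp only [mul_zero, Real.exp_zero, mul_one] at h1
  calc w T ^ 2 + w' T ^ 2
      = (w T ^ 2 + w' T ^ 2) * Real.exp (-(1 + K) * T) * Real.exp ((1 + K) * T) := by
        rw [mul_assoc, ← Real.exp_add, show -(1 + K) * T + (1 + K) * T = 0 by ring, Real.exp_zero,
          mul_one]
    _ ≤ _ := mul_le_mul_of_nonneg_right h1 (Real.exp_pos _).le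

theorem abs_taylor_one_le {Φ : ℝ → ℝ} (hΦ : ContDiff ℝ 2 Φ) {B K : ℝ}
    (hK : ∀ a b, |a| ≤ B → |b| ≤ B → |deriv Φ a - deriv Φ b| ≤ K * |a - b|) (hK0 : 0 ≤ K)
    {y z : ℝ} (hy : |y| ≤ B) (hz : |z| ≤ B) :
    |Φ z - Φ y - deriv Φ y * (z - y)| ≤ K * (z - y) ^ 2 := by
  have hd : ∀ x, HasDerivAt (fun x => Φ x - deriv Φ y * x) (deriv Φ x - deriv Φ y) x := fun x => by
    have h1 := (hΦ.differentiable (by norm_num)).differentiableAt (x := x) |>.hasDerivAt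
    exact (h1.sub ((hasDerivAt_id x).const_mul (deriv Φ y))).congr_deriv (by ring)
  have hB : ∀ x ∈ uIcc y z, |x| ≤ B := fun x hx =>
    abs_le.2 ((uIcc_subset_Icc (abs_le.1 hy) (abs_le.1 hz)) hx)
  have h1 := (convex_uIcc y z).norm_image_sub_le_of_norm_hasDerivWithin_le
    (C := K * |z - y|) (fun x _ => (hd x).hasDerivWithinAt) (fun x hx => ?_)
    left_mem_uIcc right_mem_uIcc
  · rw [Real.norm_eq_abs, Real.norm_eq_abs, mul_assoc, ← sq, sq_abs] at h1
    convert h1 using 2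
    ring
  · exact (hK x y (hB x hx) hy).trans
      (mul_le_mul_of_nonneg_left (abs_sub_left_of_mem_uIcc hx) hK0)

/-- For two solutions `U`, `Z` of `y'' = -Φ(y)` and a solution `ψ` of the linearisation along `U`,
the Wronskian of `Z - U` and `ψ` is constant up to second order. -/
theorem exists_abs_wronskian_sub_le {Φ : ℝ → ℝ} (hΦ : ContDiff ℝ 2 Φ) (B M T₀ : ℝ) :
    ∃ C ε : ℝ, 0 < ε ∧ ∀ T, 0 ≤ T → T ≤ T₀ → ∀ U U' Z Z' ψ ψ' : ℝ → ℝ,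
      Continuous U → Continuous U' → Continuous Z → Continuous Z' → Continuous ψ →
      Continuous ψ' →
      (∀ t ∈ Ioo 0 T, HasDerivAt U (U' t) t ∧ HasDerivAt U' (-Φ (U t)) t ∧
        HasDerivAt Z (Z' t) t ∧ HasDerivAt Z' (-Φ (Z t)) t ∧
        HasDerivAt ψ (ψ' t) t ∧ HasDerivAt ψ' (-(deriv Φ (U t) * ψ t)) t) →
      (∀ t ∈ Icc 0 T, |U t| ≤ B ∧ |ψ t| ≤ M) →
      (Z 0 - U 0) ^ 2 + (Z' 0 - U' 0) ^ 2 < ε →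
      |((Z T - U T) * ψ' T - (Z' T - U' T) * ψ T) - ((Z 0 - U 0) * ψ' 0 - (Z' 0 - U' 0) * ψ 0)| ≤
        C * ((Z 0 - U 0) ^ 2 + (Z' 0 - U' 0) ^ 2) := by
  obtain ⟨K, hK0, hK⟩ := (hΦ.of_le (by norm_num) : ContDiff ℝ 1 Φ).exists_abs_sub_le (B + 1)
  have hΦ' : ContDiff ℝ 1 (deriv Φ) :=
    ((contDiff_succ_iff_deriv (n := 1)).1 (hΦ.of_le (by norm_num))).2.2
  obtain ⟨K₂, hK₂0, hK₂⟩ := hΦ'.exists_abs_sub_le (B + 1)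
  -- This ε keeps the Grönwall bound on (Z - U)² below 1 up to time T₀, so the Lipschitz constants
  -- on the ball of radius B + 1 stay valid.
  refine ⟨K₂ * Real.exp ((1 + K) * T₀) * |M| * T₀, Real.exp (-((1 + K) * T₀)), Real.exp_pos _, ?_⟩
  intro T hT0 hT U U' Z Z' ψ ψ' hUc hUc' hZc hZc' hψc hψc' hd hb hε
  set E := (Z 0 - U 0) ^ 2 + (Z' 0 - U' 0) ^ 2 with hE
  have hE0 : 0 ≤ E := by positivity
  have hE1 : E * Real.exp ((1 + K) * T₀) < 1 := by
    have := mul_lt_mul_of_pos_right hε (Real.exp_pos ((1 + K) * T₀))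
    rwa [← Real.exp_add, neg_add_cancel, Real.exp_zero] at this
  have hexp : ∀ t, t ≤ T → Real.exp ((1 + K) * t) ≤ Real.exp ((1 + K) * T₀) := fun t ht =>
    Real.exp_le_exp.2 (by nlinarith)
  have energy : ∀ t, 0 ≤ t → t ≤ T → (∀ s ∈ Ioo 0 t, |Z s - U s| ≤ 1) →
      (Z t - U t) ^ 2 ≤ E * Real.exp ((1 + K) * T₀) := by
    intro t ht0 htT hs
    have hsub : ∀ s ∈ Ioo 0 t, s ∈ Ioo 0 T := fun s hs => ⟨hs.1, hs.2.trans_le htT⟩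
    have h1 := energy_le_of_second_order (w := fun t => Z t - U t) (w' := fun t => Z' t - U' t)
      (a := fun t => -Φ (Z t) - -Φ (U t)) hK0 ht0 (by fun_prop) (by fun_prop)
      (fun s hs => (hd s (hsub s hs)).2.2.1.sub (hd s (hsub s hs)).1)
      (fun s hs => (hd s (hsub s hs)).2.2.2.1.sub (hd s (hsub s hs)).2.1)
      (fun s hs' => by
        have hU := (hb s (Ioo_subset_Icc_self (hsub s hs'))).1
        have hZ : |Z s| ≤ B + 1 := by
          have := abs_add_le (Z s - U s) (U s)
          rw [sub_add_cancel] at this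
          linarith [hs s hs']
        have := hK (Z s) (U s) hZ (by linarith)
        rw [← abs_neg] at this
        convert this using 2
        ring)
    have h2 := mul_le_mul_of_nonneg_left (hexp t htT) hE0
    nlinarith [sq_nonneg (Z' t - U' t)]
  -- Continuity argument: at the first time with |Z - U| ≥ 1, the energy bound already gives (Z -
  -- U)² < 1.
  have hsmall : ∀ t ∈ Icc 0 T, |Z t - U t| < 1 := by
    by_contra! hcon
    have hclosed : IsClosed {t | t ∈ Icc 0 T ∧ 1 ≤ |Z t - U t|} :=
      isClosed_Icc.inter (isClosed_le continuous_const (hZc.sub hUc).abs)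
    have hcomp : IsCompact {t | t ∈ Icc 0 T ∧ 1 ≤ |Z t - U t|} :=
      isCompact_Icc.of_isClosed_subset hclosed fun t ht => ht.1
    obtain ⟨t₁, ht₁, hmin⟩ := hcomp.exists_isLeast hcon
    have h1 := energy t₁ ht₁.1.1 ht₁.1.2 fun s hs => by
      by_contra! h2
      exact absurd (hmin ⟨⟨hs.1.le, hs.2.le.trans ht₁.1.2⟩, h2.le⟩) (not_le.2 hs.2)
    have h2 := ht₁.2
    have h3 : 1 ≤ (Z t₁ - U t₁) ^ 2 := by
      rw [← sq_abs]; nlinarith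
    linarith
  have hw : ∀ t ∈ Icc 0 T, (Z t - U t) ^ 2 ≤ E * Real.exp ((1 + K) * T₀) := fun t ht =>
    energy t ht.1 ht.2 fun s hs => (hsmall s ⟨hs.1.le, hs.2.le.trans ht.2⟩).le
  rcases hT0.eq_or_lt with h0 | hTpos
  · rw [← h0, sub_self, abs_zero]
    have : 0 ≤ T₀ := hT0.trans hT
    positivity
  -- The linear terms cancel in the derivative of the Wronskian, which leaves the Taylor remainder
  -- of Φ times ψ.
  obtain ⟨t, ht, hslope⟩ := exists_hasDerivAt_eq_slope
    (fun t => (Z t - U t) * ψ' t - (Z' t - U' t) * ψ t)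
    (fun t => (Φ (Z t) - Φ (U t) - deriv Φ (U t) * (Z t - U t)) * ψ t) hTpos
    (Continuous.continuousOn (by fun_prop)) fun t ht => by
      obtain ⟨h1, h2, h3, h4, h5, h6⟩ := hd t ht
      refine (((h3.sub h1).mul h6).sub ((h4.sub h2).mul h5)).congr_deriv ?_
      simp only [Pi.sub_apply]
      ring
  have ht' := Ioo_subset_Icc_self ht
  rw [sub_zero, eq_div_iff hTpos.ne'] at hslope
  rw [← hslope, abs_mul, abs_mul, abs_of_pos hTpos]
  have hU := (hb t ht').1
  have hZ : |Z t| ≤ B + 1 := by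
    have := abs_add_le (Z t - U t) (U t)
    rw [sub_add_cancel] at this
    linarith [hsmall t ht']
  have h1 := abs_taylor_one_le hΦ hK₂ hK₂0 (by linarith : |U t| ≤ B + 1) hZ
  have h2 : |ψ t| ≤ |M| := ((hb t ht').2).trans (le_abs_self M)
  calc |Φ (Z t) - Φ (U t) - deriv Φ (U t) * (Z t - U t)| * |ψ t| * T
      ≤ (K₂ * (E * Real.exp ((1 + K) * T₀))) * |M| * T₀ := by
        refine mul_le_mul (mul_le_mul (h1.trans ?_) h2 (abs_nonneg _) (by positivity)) hT hT0
          (by positivity)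
        exact mul_le_mul_of_nonneg_left (hw t ht') hK₂0
    _ = K₂ * Real.exp ((1 + K) * T₀) * |M| * T₀ * E := by ring

/-! ### Differentiation along the length curve -/

/-- Since F x = 0, the slope of F G is the slope of F times G, so continuity of G suffices. Here G
will be ψ', which need not be differentiable at the interface. -/
theorem HasDerivWithinAt.mul_of_eq_zero {F G : ℝ → ℝ} {F' x : ℝ} {s : Set ℝ}
    (hF : HasDerivWithinAt F F' s x) (h0 : F x = 0) (hG : ContinuousWithinAt G s x) :
    HasDerivWithinAt (fun y => F y * G y) (F' * G x) s x := by
  rw [hasDerivWithinAt_iff_tendsto_slope] at hF ⊢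
  refine (hF.mul (hG.tendsto.mono_left (nhdsWithin_mono x sdiff_subset))).congr fun y => ?_
  simp only [slope_def_field, h0]
  ring

theorem HasDerivAt.of_sq {P : ℝ → ℝ} {d x : ℝ} (hP : ContinuousAt P x) (h0 : P x ≠ 0)
    (hd : HasDerivAt (fun y => P y ^ 2) d x) : HasDerivAt P (d / (2 * P x)) x := by
  rw [hasDerivAt_iff_tendsto_slope] at hd ⊢
  have h1 : Tendsto (fun y => P y + P x) (𝓝[≠] x) (𝓝 (2 * P x)) := by
    rw [two_mul]
    exact (hP.tendsto.mono_left nhdsWithin_le_nhds).add_const _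
  have h2 : (2 * P x) ≠ 0 := by simpa using h0
  refine (hd.div h1 h2).congr' ?_
  filter_upwards [h1.eventually_ne h2] with y hy
  simp only [slope_def_field, Pi.div_apply]
  rw [div_right_comm, sq_sub_sq, mul_div_cancel_left₀ _ hy]

/-- Derivatives of the phase point `(U, P)` at an interface, where it has constant energy for
the potential `A` and energy `y` for the potential `B`. -/
theorem hasDerivAt_interface {A B U P : ℝ → ℝ} {a g A' B' : ℝ} (hU : ContinuousAt U g)
    (hP : ContinuousAt P g) (hA : HasDerivAt A A' (U g)) (hB : HasDerivAt B B' (U g))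
    (hAE : ∀ᶠ y in 𝓝 g, P y ^ 2 / 2 + A (U y) = a) (hBE : ∀ᶠ y in 𝓝 g, P y ^ 2 / 2 + B (U y) = y)
    (hP0 : P g ≠ 0) (hAB : B' - A' ≠ 0) :
    HasDerivAt U (B' - A')⁻¹ g ∧ HasDerivAt P (-(A' * (B' - A')⁻¹) / P g) g := by
  have h1 : HasDerivAt U (B' - A')⁻¹ g := by
    refine HasDerivAt.of_local_left_inverse (f := fun z => B z - A z + a) hU
      ((hB.sub hA).add_const a) hAB ?_
    filter_upwards [hAE, hBE] with y h1 h2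
    linarith
  refine ⟨h1, ?_⟩
  have h2 : HasDerivAt (fun y => P y ^ 2) (-2 * (A' * (B' - A')⁻¹)) g := by
    refine (((hA.comp g h1).const_sub a).const_mul 2).congr_of_eventuallyEq ?_ |>.congr_deriv ?_
    · filter_upwards [hAE] with y hy
      simp only [Function.comp]
      linarith
    · ring
  refine (HasDerivAt.of_sq hP hP0 h2).congr_deriv ?_
  field_simp

/-- On one side of g the values of L lie below L g. Derivatives at g taken along this set are
therefore unique, and only fronts with a shorter middle interval need be compared. -/
theorem accPt_sublevel_of_deriv_ne_zero {L : ℝ → ℝ} {L' g : ℝ} {G : Set ℝ} (hG : G ∈ 𝓝 g)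
    (hL : HasDerivAt L L' g) (hL' : L' ≠ 0) : AccPt g (𝓟 {y | y ∈ G ∧ L y ≤ L g}) := by
  rw [hasDerivAt_iff_tendsto_slope] at hL
  have key : ∀ s : Set ℝ, (𝓝[s] g).NeBot → s ⊆ {g}ᶜ →
      (∀ᶠ y in 𝓝[s] g, L y ≤ L g) → AccPt g (𝓟 {y | y ∈ G ∧ L y ≤ L g}) := by
    intro s hs hsub hev
    refine NeBot.mono hs (le_inf (nhdsWithin_mono g hsub) (le_principal_iff.2 ?_))
    filter_upwards [hev, nhdsWithin_le_nhds hG] with y h1 h2 using ⟨h2, h1⟩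
  rcases lt_or_gt_of_ne hL' with h | h
  · refine key (Ioi g) inferInstance (fun y hy => (mem_Ioi.1 hy).ne') ?_
    filter_upwards [nhdsWithin_mono g (fun y hy => (mem_Ioi.1 hy).ne') (hL.eventually
      (gt_mem_nhds h)), self_mem_nhdsWithin] with y hy hy'
    rw [slope_def_field] at hy
    have h2 : 0 < y - g := sub_pos.2 hy'
    have := (div_neg_iff.1 hy)
    rcases this with h3 | h3 <;> linarith [h3.1, h3.2]
  · refine key (Iio g) inferInstance (fun y hy => (mem_Iio.1 hy).ne) ?_
    filter_upwards [nhdsWithin_mono g (fun y hy => (mem_Iio.1 hy).ne) (hL.eventually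
      (lt_mem_nhds h)), self_mem_nhdsWithin] with y hy hy'
    rw [slope_def_field] at hy
    have h2 : y - g < 0 := sub_neg.2 hy'
    have := (div_pos_iff.1 hy)
    rcases this with h3 | h3 <;> linarith [h3.1, h3.2]

namespace IsStationaryFront

variable {V : PiecewisePotential} {L um up : ℝ} {u : ℝ → ℝ}

theorem hamiltonian_left (h : IsStationaryFront V L um up u) (hL : 0 < L) :
    deriv u (-L) ^ 2 / 2 + V.Vl (u (-L)) = V.Vl um := by
  have h1 := (h.reflect hL).hamiltonian_right hL
  rwa [h.deriv_comp_neg, neg_sq] at h1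

theorem hasDerivAt_deriv_middle (h : IsStationaryFront V L um up u) {x : ℝ}
    (hx : x ∈ Ioo (-L) L) : HasDerivAt (deriv u) (-(deriv V.Vm (u x))) x := by
  rw [← V.du_middle (u x) hx.1.le hx.2.le]
  exact h.ode x hx.1.ne' hx.2.ne

/-- Only a left derivative is available, since u_xx may jump at L; it is the limit of u_xx from
inside the middle interval. -/
theorem hasDerivWithinAt_deriv_Iic (h : IsStationaryFront V L um up u) (hL : 0 < L) :
    HasDerivWithinAt (deriv u) (-(deriv V.Vm (u L))) (Iic L) L := by
  have hL' : -L < L := by linarith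
  refine hasDerivWithinAt_Iic_of_tendsto_deriv (s := Ioo (-L) L)
    (fun x hx => (h.hasDerivAt_deriv_middle hx).differentiableAt.differentiableWithinAt)
    h.continuous_deriv.continuousWithinAt (Ioo_mem_nhdsLT hL') ?_
  have hc : Continuous fun x => -(deriv V.Vm (u x)) :=
    (V.contDiff_m.deriv_of_three.continuous.comp h.contDiff.continuous).neg
  refine (hc.continuousAt.tendsto.mono_left nhdsWithin_le_nhds).congr' ?_
  filter_upwards [Ioo_mem_nhdsLT hL'] with x hx using (h.hasDerivAt_deriv_middle hx).deriv.symm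

end IsStationaryFront

namespace IsLengthCurve

variable {V : PiecewisePotential} {um up : ℝ} {G : Set ℝ} {L : ℝ → ℝ} {uf : ℝ → ℝ → ℝ}

theorem hamiltonian_Icc (h : IsLengthCurve V um up G L uf) {g : ℝ} (hg : g ∈ G) :
    ∀ x ∈ Icc (-(L g)) (L g), deriv (uf g) x ^ 2 / 2 + V.Vm (uf g x) = g := by
  have hf := h.front g hg
  have hc : Continuous fun x => deriv (uf g) x ^ 2 / 2 + V.Vm (uf g x) := by
    have := hf.continuous_deriv
    have := V.contDiff_m.continuous.comp hf.contDiff.continuous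
    fun_prop
  have h1 : closure (Ioo (-(L g)) (L g)) ⊆
      {x | deriv (uf g) x ^ 2 / 2 + V.Vm (uf g x) = g} :=
    closure_minimal (h.hamiltonian g hg) (isClosed_eq hc continuous_const)
  rw [closure_Ioo (by linarith [h.pos g hg])] at h1
  exact fun x hx => h1 hx

/-- The Wronskian at the right end of the middle interval of a solution `ψ` of the linearised
equation, continuing `u_x` from the left interval, with `u_x` on the right interval. -/
theorem wronskian_eq (h : IsLengthCurve V um up G L uf) {g : ℝ} (hg : g ∈ G)
    (hBl : bifLeft V (L g) (uf g) ≠ 0) (hBr : bifRight V (L g) (uf g) ≠ 0)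
    (hL' : deriv L g ≠ 0) {ψ ψ' : ℝ → ℝ} (hψ : ∀ x, HasDerivAt ψ (ψ' x) x)
    (hψc' : Continuous ψ')
    (hψ' : ∀ x ∈ Ioo (-(L g)) (L g),
      HasDerivAt ψ' (-(deriv (deriv V.Vm) (uf g x) * ψ x)) x)
    (h0 : ψ (-(L g)) = deriv (uf g) (-(L g)))
    (h0' : ψ' (-(L g)) = -deriv V.Vl (uf g (-(L g)))) :
    -(ψ (L g) * deriv V.Vr (uf g (L g))) - ψ' (L g) * deriv (uf g) (L g) =
      2 * deriv L g * bifLeft V (L g) (uf g) * bifRight V (L g) (uf g) := by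
  have hG : G ∈ 𝓝 g := h.isOpen.mem_nhds hg
  have hf := h.front g hg
  have hLpos := h.pos g hg
  have hLd : HasDerivAt L (deriv L g) g :=
    ((h.contDiffOn.contDiffAt hG).differentiableAt (by norm_num)).hasDerivAt
  have hψc : Continuous ψ := continuous_iff_continuousAt.2 fun x => (hψ x).continuousAt
  set ℓ := L g with hℓ
  set u := uf g with hu
  set ul := u (-ℓ) with hul
  set pl := deriv u (-ℓ) with hpl
  set ur := u ℓ with hur
  set pr := deriv u ℓ with hpr
  set Bl := bifLeft V ℓ u with hBl_def
  set Br := bifRight V ℓ u with hBr_def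
  have hBl' : Bl = pl * (deriv V.Vm ul - deriv V.Vl ul) := rfl
  have hBr' : Br = pr * (deriv V.Vr ur - deriv V.Vm ur) := rfl
  have hpl0 : pl ≠ 0 := left_ne_zero_of_mul (hBl' ▸ hBl)
  have hml : deriv V.Vm ul - deriv V.Vl ul ≠ 0 := right_ne_zero_of_mul (hBl' ▸ hBl)
  have hpr0 : pr ≠ 0 := left_ne_zero_of_mul (hBr' ▸ hBr)
  have hmr : deriv V.Vm ur - deriv V.Vr ur ≠ 0 := by
    have := right_ne_zero_of_mul (hBr' ▸ hBr)
    rw [← neg_sub]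
    exact neg_ne_zero.2 this
  obtain ⟨hul_d, hpl_d⟩ := hasDerivAt_interface (A := V.Vl) (B := V.Vm)
    (U := fun y => uf y (-(L y))) (P := fun y => deriv (uf y) (-(L y))) (a := V.Vl um)
    (h.continuousOn_ul.continuousAt hG) (h.continuousOn_pl.continuousAt hG)
    (V.contDiff_l.hasDerivAt_of_three _) (V.contDiff_m.hasDerivAt_of_three _)
    (by filter_upwards [hG] with y hy using (h.front y hy).hamiltonian_left (h.pos y hy))
    (by filter_upwards [hG] with y hy using
          h.hamiltonian_Icc hy _ (left_mem_Icc.2 (by linarith [h.pos y hy])))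
    hpl0 hml
  obtain ⟨hur_d, hpr_d⟩ := hasDerivAt_interface (A := V.Vr) (B := V.Vm)
    (U := fun y => uf y (L y)) (P := fun y => deriv (uf y) (L y)) (a := V.Vr up)
    (h.continuousOn_ur.continuousAt hG) (h.continuousOn_pr.continuousAt hG)
    (V.contDiff_r.hasDerivAt_of_three _) (V.contDiff_m.hasDerivAt_of_three _)
    (by filter_upwards [hG] with y hy using (h.front y hy).hamiltonian_right (h.pos y hy))
    (by filter_upwards [hG] with y hy using
          h.hamiltonian_Icc hy _ (right_mem_Icc.2 (by linarith [h.pos y hy])))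
    hpr0 hmr
  -- For these y the reference orbit, followed for time 2 L(y) from -ℓ, stays in the middle
  -- interval.
  set s : Set ℝ := {y | y ∈ G ∧ L y ≤ L g} with hs
  have hacc : UniqueDiffWithinAt ℝ s g :=
    uniqueDiffWithinAt_iff_accPt.2 (accPt_sublevel_of_deriv_ne_zero hG hLd hL')
  set Θ₀ : ℝ → ℝ := fun y => (uf y (-(L y)) - ul) * ψ' (-ℓ) -
    (deriv (uf y) (-(L y)) - pl) * ψ (-ℓ) with hΘ₀
  set E : ℝ → ℝ := fun y => (uf y (-(L y)) - ul) ^ 2 + (deriv (uf y) (-(L y)) - pl) ^ 2 with hE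
  -- The position on the reference front at which the y-front reaches its right interface, when both
  -- start at their left interfaces.
  set e : ℝ → ℝ := fun y => 2 * L y - ℓ with he
  have heg : e g = ℓ := by simp only [he, hℓ]; ring
  set Θ : ℝ → ℝ := fun y => (uf y (L y) - u (e y)) * ψ' (e y) -
    (deriv (uf y) (L y) - deriv u (e y)) * ψ (e y) with hΘ
  -- The variation of the left phase point is tangent to the V_l energy curve, hence parallel to
  -- (p_l, -V_l'), the Cauchy data of ψ.
  have hΘ₀_d : HasDerivAt Θ₀ 0 g := by
    refine (((hul_d.sub_const ul).mul_const (ψ' (-ℓ))).sub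
      ((hpl_d.sub_const pl).mul_const (ψ (-ℓ)))).congr_deriv ?_
    rw [h0, h0']
    change (deriv V.Vm ul - deriv V.Vl ul)⁻¹ * -deriv V.Vl ul -
      -(deriv V.Vl ul * (deriv V.Vm ul - deriv V.Vl ul)⁻¹) / pl * pl = 0
    rw [div_mul_cancel₀ _ hpl0]
    ring
  have hE_d : HasDerivAt E 0 g := by
    refine (((hul_d.sub_const ul).pow 2).add ((hpl_d.sub_const pl).pow 2)).congr_deriv ?_
    simp [hul, hpl, hu, hℓ]
  have hEg : E g = 0 := by simp [hE, hul, hpl, hu, hℓ]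
  have hΘ₀g : Θ₀ g = 0 := by simp [hΘ₀, hul, hpl, hu, hℓ]
  have hΘg : Θ g = 0 := by simp only [hΘ, heg]; simp [hu, hℓ]
  obtain ⟨B, -, -, hB⟩ := hf.exists_abs_le hLpos
  obtain ⟨M, -, hM⟩ := hψc.exists_abs_le_of_abs_le ℓ
  obtain ⟨C, ε, hε, hW⟩ := exists_abs_wronskian_sub_le V.contDiff_m.deriv_of_three B M (2 * ℓ)
  have hclose : ∀ᶠ y in 𝓝[s] g, |Θ y - Θ₀ y| ≤ C * E y := by
    have hEε : ∀ᶠ y in 𝓝[s] g, E y < ε :=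
      nhdsWithin_le_nhds (hE_d.continuousAt.eventually (gt_mem_nhds (hEg ▸ hε)))
    filter_upwards [hEε, self_mem_nhdsWithin] with y hyε hy
    have hfy := h.front y hy.1
    have hyL : L y ≤ ℓ := hy.2
    have hyp := h.pos y hy.1
    have hshift : ∀ (F : ℝ → ℝ) (d c t : ℝ), HasDerivAt F d (t - c) →
        HasDerivAt (fun t => F (t - c)) d t := fun F d c t hF => hF.comp_sub_const t c
    have hfc := hf.contDiff.continuous
    have hfc' := hf.continuous_deriv
    have hfyc := hfy.contDiff.continuous
    have hfyc' := hfy.continuous_deriv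
    have := hW (2 * L y) (by linarith) (by linarith)
      (fun t => u (t - ℓ)) (fun t => deriv u (t - ℓ)) (fun t => uf y (t - L y))
      (fun t => deriv (uf y) (t - L y)) (fun t => ψ (t - ℓ)) (fun t => ψ' (t - ℓ))
      (by fun_prop) (by fun_prop) (by fun_prop) (by fun_prop) (by fun_prop) (by fun_prop)
      (fun t ht => by
        have h1 : t - ℓ ∈ Ioo (-ℓ) ℓ := ⟨by linarith [ht.1], by linarith [ht.2]⟩
        have h2 : t - L y ∈ Ioo (-(L y)) (L y) := ⟨by linarith [ht.1], by linarith [ht.2]⟩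
        exact ⟨hshift _ _ _ _ (hf.hasDerivAt _), hshift _ _ _ _ (hf.hasDerivAt_deriv_middle h1),
          hshift _ _ _ _ (hfy.hasDerivAt _), hshift _ _ _ _ (hfy.hasDerivAt_deriv_middle h2),
          hshift _ _ _ _ (hψ _), hshift _ _ _ _ (hψ' _ h1)⟩)
      (fun t ht => ⟨hB _, hM _ (abs_le.2 ⟨by linarith [ht.1], by linarith [ht.2]⟩)⟩)
      (by simpa only [zero_sub] using hyε)
    simpa only [zero_sub, show 2 * L y - L y = L y by ring] using this
  -- E is quadratic in the variation of the left endpoint, so the error C E is o(y - g) and Θ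
  -- inherits the zero derivative of Θ₀.
  have hΘ_zero : HasDerivWithinAt Θ 0 s g := by
    have h1 : HasDerivWithinAt (fun y => Θ y - Θ₀ y) 0 s g := by
      rw [hasDerivWithinAt_iff_isLittleO]
      have h2 := hasDerivWithinAt_iff_isLittleO.1 (hE_d.hasDerivWithinAt (s := s))
      simp only [hEg, hΘg, hΘ₀g, sub_zero, smul_zero] at h2 ⊢
      refine Asymptotics.IsBigO.trans_isLittleO (Asymptotics.IsBigO.of_bound |C| ?_) h2
      filter_upwards [hclose] with y hy
      rw [Real.norm_eq_abs, Real.norm_eq_abs, ← abs_mul]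
      exact hy.trans (le_abs_self _)
    have h2 := h1.add (hΘ₀_d.hasDerivWithinAt (s := s))
    rw [add_zero] at h2
    refine h2.congr_of_eventuallyEq (Eventually.of_forall fun y => ?_) ?_ <;> simp
  have he_d : HasDerivAt e (2 * deriv L g) g := (hLd.const_mul 2).sub_const ℓ
  have hu_d : HasDerivAt (fun y => u (e y)) (pr * (2 * deriv L g)) g := by
    have h1 := hf.hasDerivAt (e g)
    have h2 := h1.comp g he_d
    rw [heg] at h2
    exact h2
  have hu_d' : HasDerivWithinAt (fun y => deriv u (e y))
      (-(deriv V.Vm ur) * (2 * deriv L g)) s g := by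
    have h1 := hf.hasDerivWithinAt_deriv_Iic hLpos
    rw [← heg] at h1
    have h2 := h1.comp g (he_d.hasDerivWithinAt (s := s)) fun y hy => by
      have := hy.2
      simp only [he, mem_Iic]
      linarith
    rw [heg] at h2
    exact h2
  have heC : ContinuousWithinAt e s g := he_d.continuousAt.continuousWithinAt
  have hΘ_d : HasDerivWithinAt Θ
      (((deriv V.Vm ur - deriv V.Vr ur)⁻¹ - pr * (2 * deriv L g)) * ψ' ℓ -
        (-(deriv V.Vr ur * (deriv V.Vm ur - deriv V.Vr ur)⁻¹) / pr -
          -(deriv V.Vm ur) * (2 * deriv L g)) * ψ ℓ) s g := by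
    have h1 := HasDerivWithinAt.mul_of_eq_zero (hur_d.sub hu_d).hasDerivWithinAt
      (by simp only [Pi.sub_apply, heg]; simp [hu, hℓ])
      (hψc'.continuousAt.comp_continuousWithinAt heC)
    have h2 := HasDerivWithinAt.mul_of_eq_zero (hpr_d.hasDerivWithinAt.sub hu_d')
      (by simp only [Pi.sub_apply, heg]; simp [hu, hℓ])
      (hψc.continuousAt.comp_continuousWithinAt heC)
    have h3 := h1.sub h2
    simp only [Function.comp_apply, heg] at h3
    exact h3
  -- The directly computed derivative of Θ, with its terms in L' from the moving endpoint, must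
  -- equal 0.
  have hX := hacc.eq_deriv s hΘ_d hΘ_zero
  -- The Wronskian of u_x and ψ is constant on the middle interval; its value at -ℓ is B_l.
  have hmid : pr * ψ' ℓ + deriv V.Vm ur * ψ ℓ = Bl := by
    have hfc := hf.contDiff.continuous
    have hfc' := hf.continuous_deriv
    have hVc := V.contDiff_m.deriv_of_three.continuous
    obtain ⟨t, ht, hslope⟩ := exists_hasDerivAt_eq_slope
      (fun x => deriv u x * ψ' x + deriv V.Vm (u x) * ψ x) (fun _ => 0)
      (by linarith : -ℓ < ℓ) (Continuous.continuousOn (by fun_prop)) fun x hx => by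
        have h1 := (V.contDiff_m.hasDerivAt_deriv_of_three (u x)).comp x (hf.hasDerivAt x)
        refine (((hf.hasDerivAt_deriv_middle hx).mul (hψ' x hx)).add
          (h1.mul (hψ x))).congr_deriv ?_
        simp only [Function.comp_apply]
        ring
    rw [eq_div_iff (by linarith), zero_mul, h0, h0'] at hslope
    rw [hBl']
    linarith
  have hcancel : (deriv V.Vm ur - deriv V.Vr ur)⁻¹ = -(pr / Br) := by
    have h1 : deriv V.Vr ur - deriv V.Vm ur ≠ 0 := by
      rw [← neg_sub]; exact neg_ne_zero.2 hmr
    rw [hBr', div_mul_eq_div_div, div_self hpr0, ← neg_sub, inv_neg, one_div]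
  rw [hcancel] at hX
  have hX' : pr * ψ' ℓ + deriv V.Vr ur * ψ ℓ +
      2 * deriv L g * Br * (pr * ψ' ℓ + deriv V.Vm ur * ψ ℓ) = 0 := by
    field_simp at hX
    linarith
  rw [hmid] at hX'
  linarith

end IsLengthCurve

/-! ### Asymptotic signs and the conclusion -/

theorem eventually_ne_zero_of_asymptoticSign_ne_zero {u : ℝ → ℝ} (h : asymptoticSign u ≠ 0) :
    ∀ᶠ x in atTop, deriv u x * deriv u (-x) ≠ 0 := by
  unfold asymptoticSign at h
  split_ifs at h with h1 h2
  · exact h1.mono fun x hx => hx.ne'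
  · exact h2.mono fun x hx => hx.ne
  · exact absurd rfl h

theorem asymptoticSign_eq {u : ℝ → ℝ} {σ : ℝ} (hσ : σ = 1 ∨ σ = -1)
    (h : ∀ᶠ x in atTop, 0 < σ * (deriv u x * deriv u (-x))) : asymptoticSign u = σ := by
  unfold asymptoticSign
  rcases hσ with rfl | rfl
  · rw [if_pos (h.mono fun x hx => by linarith)]
  · have h1 : ∀ᶠ x in atTop, deriv u x * deriv u (-x) < 0 := h.mono fun x hx => by linarith
    rw [if_neg, if_pos h1]
    intro h2
    obtain ⟨x, hx1, hx2⟩ := (h1.and h2).exists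
    linarith

end

theorem theorem3 (V : PiecewisePotential) (um up : ℝ) (G : Set ℝ) (L : ℝ → ℝ) (uf : ℝ → ℝ → ℝ)
    (hcurve : IsLengthCurve V um up G L uf) (g : ℝ) (hg : g ∈ G)
    (hsimple : HasSimpleDerivZeros (L g) (uf g))
    (hpos : 0 < asymptoticSign (uf g) * bifLeft V (L g) (uf g) * bifRight V (L g) (uf g)
      * deriv L g) :
    ∃ Λ : ℝ, 0 < Λ ∧ IsLinearisationEigenvalue V (L g) (uf g) Λ := by
  have hL' : deriv L g ≠ 0 := right_ne_zero_of_mul hpos.ne'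
  have hBr : bifRight V (L g) (uf g) ≠ 0 :=
    right_ne_zero_of_mul (left_ne_zero_of_mul hpos.ne')
  have hBl : bifLeft V (L g) (uf g) ≠ 0 :=
    right_ne_zero_of_mul (left_ne_zero_of_mul (left_ne_zero_of_mul hpos.ne'))
  have hPi : asymptoticSign (uf g) ≠ 0 :=
    left_ne_zero_of_mul (left_ne_zero_of_mul (left_ne_zero_of_mul hpos.ne'))
  have hLpos := hcurve.pos g hg
  have hf := hcurve.front g hg
  have hr := hf.reflect hLpos
  have hne := eventually_ne_zero_of_asymptoticSign_ne_zero hPi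
  obtain ⟨σ, hσ, hσpos⟩ := eventually_pos_or_neg_of_eventually_ne_zero hf.continuous_deriv
    (hne.mono fun x hx => left_ne_zero_of_mul hx)
  obtain ⟨τ, hτ, hτpos⟩ := eventually_pos_or_neg_of_eventually_ne_zero hr.continuous_deriv
    (hne.mono fun x hx => by
      rw [hf.deriv_comp_neg]
      exact neg_ne_zero.2 (right_ne_zero_of_mul hx))
  have hτsq : τ * τ = 1 := by rcases hτ with rfl | rfl <;> norm_num
  -- The minus sign arises because τ is the sign of the derivative of the reflected front, which is
  -- -u_x near -∞.
  have hsign : asymptoticSign (uf g) = -(σ * τ) := by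
    refine asymptoticSign_eq (by rcases hσ with rfl | rfl <;> rcases hτ with rfl | rfl <;> norm_num)
      ?_
    filter_upwards [hσpos, hτpos] with x h1 h2
    rw [hf.deriv_comp_neg] at h2
    nlinarith [mul_pos h1 h2]
  obtain ⟨f, f', hjf, c, hc, hc1, hc2⟩ := hf.exists_isJostFamily hLpos hσpos
  obtain ⟨k, k', hjk, d, hd, hd1, hd2⟩ := hr.exists_isJostFamily hLpos hτpos
  rw [hf.deriv_comp_neg] at hd1
  change -(τ * deriv V.Vl (uf g (-(L g)))) = d * k' 0 (L g) at hd2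
  simp only [V.swap_duu _ hLpos] at hjk
  set q : ℝ → ℝ := fun x => V.duu (L g) (uf g x) x with hq
  have hjk' : IsJostFamily (fun x => q (-x)) {-(L g), L g} k k' := hjk
  have hS : ({-(L g), L g} : Set ℝ).Countable := Set.to_countable _
  have hsymm : ∀ x ∉ ({-(L g), L g} : Set ℝ), -x ∉ ({-(L g), L g} : Set ℝ) := fun x hx => by
    simp only [mem_insert_iff, mem_singleton_iff, not_or] at hx ⊢
    exact ⟨fun h => hx.2 (by linarith), fun h => hx.1 (by linarith)⟩
  -- The left Jost function k 0 (-x) is rescaled so that its Cauchy data at -L are those of u_x from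
  -- the left; τ² = 1 makes the factor -τ d the right one.
  have hW := hcurve.wronskian_eq hg hBl hBr hL' (ψ := fun x => -(τ * d) * k 0 (-x))
    (ψ' := fun x => τ * d * k' 0 (-x))
    (fun x => ((hasDerivAt_comp_neg_of_eq (hjk.hasDerivAt 0 le_rfl (-x)) rfl).const_mul
      (-(τ * d))).congr_deriv (by ring))
    (by have := hjk.continuous_deriv 0 le_rfl; fun_prop)
    (fun x hx => by
      have hxS : x ∉ ({-(L g), L g} : Set ℝ) := by
        simp only [mem_insert_iff, mem_singleton_iff, not_or]
        exact ⟨hx.1.ne', hx.2.ne⟩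
      have h1 := hjk'.ode 0 le_rfl (-x) (hsymm x hxS)
      refine ((hasDerivAt_comp_neg_of_eq h1 rfl).const_mul (τ * d)).congr_deriv ?_
      rw [neg_neg, hq]
      simp only [V.duu_eq, if_neg (not_lt.2 hx.1.le), if_pos hx.2.le]
      ring)
    (by
      rw [neg_neg]
      linear_combination (τ : ℝ) * hd1 + deriv (uf g) (-(L g)) * hτsq)
    (by
      rw [neg_neg]
      linear_combination -(τ : ℝ) * hd2 - deriv V.Vl (uf g (-(L g))) * hτsq)
  have hWpos : 0 < k 0 0 * f' 0 0 + k' 0 0 * f 0 0 := by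
    have h1 := hjf.wronskian_eq hjk' hS hsymm le_rfl 0 (L g)
    rw [neg_zero] at h1
    rw [h1]
    set W := k 0 (-(L g)) * f' 0 (L g) + k' 0 (-(L g)) * f 0 (L g) with hWdef
    -- The Wronskian may be evaluated at L, where the right Jost function is σ / c times u_x and the
    -- left one is -τ / d times ψ.
    have h2 : c * d * W = 2 * (asymptoticSign (uf g) * bifLeft V (L g) (uf g) *
        bifRight V (L g) (uf g) * deriv L g) := by
      rw [hsign, hWdef]
      linear_combination -(d * k 0 (-(L g))) * hc2 - (d * k' 0 (-(L g))) * hc1 - σ * τ * hW -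
        (d * k' 0 (-(L g)) * σ * deriv (uf g) (L g) -
          d * k 0 (-(L g)) * σ * deriv V.Vr (uf g (L g))) * hτsq
    have h3 : 0 < c * d * W := by rw [h2]; linarith
    exact (mul_pos_iff_of_pos_left (mul_pos hc hd)).1 h3
  obtain ⟨K, -, -, hK⟩ := hf.exists_abs_duu_le hLpos
  obtain ⟨Λ, hΛ, Ψ, Ψ₁, Ψ₂, h1, h2, h3, h4, h5, h6, h7⟩ :=
    hjf.exists_eigenfunction hjk' hS hsymm hf.measurable_duu hK hWpos
  exact ⟨Λ, hΛ, Ψ, Ψ₁, Ψ₂, h1, h2, h3, h4, h5, h6, Eventually.of_forall h7⟩
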